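/- Let $$\omega_B(s)=\sum_{m,n\ge 1}\frac{1}{m^s n^s (m+n)^s (m+2n)^s},\qquad \omega_G(s)=\sum_{m,n\ge 1}\frac{1}{m^s n^s (m+n)^s (m+2n)^s (m+3n)^s (2m+3n)^s}.$$ These double series converge absolutely for $\Re(s)>\tfrac12$ and $\Re(s)>\tfrac13$ respectively, and both functions continue meromorphically to $\mathbb{C}$; denote the continuations by the same symbols. Let $\zeta$ be the Riemann zeta function and write $[x^n]h(x)$ for the coefficient of $x^n$ in the power series expansion of $h$ around $x=0$. (a) For every integer $n\ge 0$, the residue of $\omega_B$ at $s=\frac{1-n}{3}$ is $$\frac13\,\zeta\!\left(\frac{1-4n}{3}\right)\left(1+2^{(-1-2n)/3}\right)b_n,\qquad b_n=[x^n]\big((1+x)(1+2x)\big)^{(n-1)/3}\in\mathbb{Q}.$$ Moreover, for all $n\ge 0$, $$27(n+4)(n+6)\,b_{n+6}-4(n+2)(n+5)\,b_n=0.$$ (b) For every integer $n\ge 0$, the residue of $\omega_G$ at $s=\frac{1-n}{5}$ is $$\frac15\,\zeta\!\left(\frac{1-6n}{5}\right)\left(1+3^{(-3n-2)/5}\right)2^{(n-1)/5}\,g_n,\qquad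 g_n=[x^n]\big((1+x)(1+2x)(1+3x)(1+\tfrac32x)\big)^{(n-1)/5}\in\mathbb{Q}.$$ Moreover, for all $n\ge 0$, $$\begin{aligned}&729(n+4)(n+9)(n+14)(n+19)(6n+103)\,g_n\\&\quad-1875(n+14)(n+19)\left(216n^3+7596n^2+83694n+290603\right)g_{n+10}\\&\quad+50000(n+12)(n+16)(n+18)(n+20)(6n+43)\,g_{n+20}=0.\end{aligned}$$ (Where the function is analytic at the point in question, its residue there is $0$.) -/

import Mathlib

open Filter Topology

/-- The general term `1 / (m^s n^s (m+n)^s (m+2n)^s)` of the double series `ω_B(s)`;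
the pair `p` is `(m, n)` with `m, n ≥ 1`. -/
noncomputable def omegaBTerm (s : ℂ) (p : ℕ+ × ℕ+) : ℂ :=
  let m : ℂ := ((p.1 : ℕ) : ℂ)
  let n : ℂ := ((p.2 : ℕ) : ℂ)
  1 / (m ^ s * n ^ s * (m + n) ^ s * (m + 2 * n) ^ s)

/-- The general term `1 / (m^s n^s (m+n)^s (m+2n)^s (m+3n)^s (2m+3n)^s)` of the double series
`ω_G(s)`; the pair `p` is `(m, n)` with `m, n ≥ 1`. -/
noncomputable def omegaGTerm (s : ℂ) (p : ℕ+ × ℕ+) : ℂ :=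
  let m : ℂ := ((p.1 : ℕ) : ℂ)
  let n : ℂ := ((p.2 : ℕ) : ℂ)
  1 / (m ^ s * n ^ s * (m + n) ^ s * (m + 2 * n) ^ s * (m + 3 * n) ^ s * (2 * m + 3 * n) ^ s)

/-- `Ω` is a meromorphic function on the whole complex plane which on the half-plane `Re s > σ`
is the sum of the (unconditionally, hence absolutely, convergent) double series with general
term `term s (m, n)`. -/
def IsMeromorphicContinuation (term : ℂ → ℕ+ × ℕ+ → ℂ) (σ : ℝ) (Ω : ℂ → ℂ) : Prop :=
  Meromorphic Ω ∧ ∀ s : ℂ, σ < s.re → HasSum (term s) (Ω s)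

/-- `f` is meromorphic at `z₀` with residue `r` there: the integral of `f` over every sufficiently
small circle around `z₀`, divided by `2πi`, is `r`. -/
def HasResidueAt (f : ℂ → ℂ) (z₀ r : ℂ) : Prop :=
  MeromorphicAt f z₀ ∧
    ∀ᶠ ρ : ℝ in 𝓝[>] 0, (2 * (Real.pi : ℂ) * Complex.I)⁻¹ * (∮ z in C(z₀, ρ), f z) = r

/-- The coefficient of `x ^ n` in the power series expansion around `x = 0` of a function
`h` which is analytic at `0`. -/
noncomputable def expansionCoeff (h : ℝ → ℝ) (n : ℕ) : ℝ :=
  iteratedDeriv n h 0 / (n.factorial : ℝ)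

/-- `b_n = [x^n] ((1+x)(1+2x))^((n-1)/3)`. -/
noncomputable def bCoeff (n : ℕ) : ℝ :=
  expansionCoeff (fun x => ((1 + x) * (1 + 2 * x)) ^ (((n : ℝ) - 1) / 3)) n

/-- `g_n = [x^n] ((1+x)(1+2x)(1+3x)(1+(3/2)x))^((n-1)/5)`. -/
noncomputable def gCoeff (n : ℕ) : ℝ :=
  expansionCoeff
    (fun x => ((1 + x) * (1 + 2 * x) * (1 + 3 * x) * (1 + 3 / 2 * x)) ^ (((n : ℝ) - 1) / 5)) n

/-!
The continuation comes from cutting the lattice quadrant along the diagonal. With `e = 3` or `e = 5`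
and `φ` a polynomial of degree at most `e`, each half of the double series is a sum over
`m ≥ n ≥ 1` of `n ^ (-s) m ^ (-e s) φ(n/m) ^ (-s)`, the diagonal having weight `1 / 2`. This term is
`n ^ (-(e + 1) s) F_s(m/n)` with `F_s(x) = x ^ (-e s) φ(1/x) ^ (-s)`. Euler–Maclaurin summation over
`m` (`tendsto_eulerMaclaurin`) followed by summation over `n` turns the half into
`ζ((e + 1) s - 1) ∫_1^∞ F_s`, plus constants times `ζ((e + 1) s + k) F_s^(k)(1)` for `k ≥ 1`, plus a
remainder (`hasSum_halfTerm`). The derivatives of `F_s` are powers of `x` and `φ(1/x)` times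
polynomials in `s` and `1/x`, so each further derivative gains a factor `1/x` locally uniformly in
`s`; therefore the remainder is holomorphic in any prescribed disc when the order is large
(`analyticAt_tsum_remTerm`). The integral becomes `∫_0^1 y ^ (e s - 2) φ(y) ^ (-s) dy`, which
integration by parts continues meromorphically. Its poles are at `s = (1 - n) / e`, and the residue
there is `1 / e` times the `n`-th Taylor coefficient of `φ ^ ((n - 1) / e)` at `0`
(`hasSimplePoleAt_rayContinuation`). The continuations to discs agree by the identity theorem and
glue (`exists_isMeromorphicContinuation`).

The factor `ζ((e + 1) s + k)` can have its pole at `s = (1 - n) / e` only if `s` is an integer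
`-p ≤ 0` and `k = (e + 1) p + 1`; there `F_s` is a polynomial of degree at most `e p < k`, so that
`F_s^(k)(1) = 0` and the residue is not affected (`hasSimplePoleAt_halfContinuation`). The two
halves of each series have the polynomials `c φ(μ y)` for one and the same `φ`, and this gives the
two summands in the stated residues (`ConeSeries.hasResidueAt`).

The recurrences express that a derivative has no residue. For `h = φ ^ ((n - 1) / e)` all
coefficients involved are coefficients of one power `x ^ N` in polynomial multiples of `h`, and an
explicit polynomial `Q` makes the combination equal to `x (φ Q h)' - N φ Q h`, whose coefficient of
`x ^ N` is zero (`coeff_mul_eq_zero_of_certificate`).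
-/

open Polynomial

/-! ### Derivatives of a power of a polynomial -/

/-- The polynomials `P_k` with `(d/dy)^k φ(y)^α = φ(y)^(α - k) * P_k(y)`. They make sense over every
commutative ring, so that `α` can be a number or an indeterminate. -/
noncomputable def derivPoly {R : Type*} [CommRing R] (φ : R[X]) (α : R) : ℕ → R[X]
  | 0 => 1
  | k + 1 => φ * derivative (derivPoly φ α k) + C (α - k) * derivative φ * derivPoly φ α k

theorem derivPoly_map {R S : Type*} [CommRing R] [CommRing S] (f : R →+* S) (φ : R[X]) (α : R)
    (k : ℕ) : (derivPoly φ α k).map f = derivPoly (φ.map f) (f α) k := by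
  induction k with
  | zero => simp [derivPoly]
  | succ k ih => simp [derivPoly, ← ih, derivative_map]

theorem derivPoly_scale {R : Type*} [CommRing R] (φ : R[X]) (α c μ : R) (k : ℕ) :
    derivPoly (C c * φ.comp (C μ * X)) α k
      = C (c ^ k * μ ^ k) * (derivPoly φ α k).comp (C μ * X) := by
  induction k with
  | zero => simp [derivPoly]
  | succ k ih =>
    simp only [derivPoly, ih, derivative_mul, derivative_C, derivative_comp, derivative_X,
      add_comp, mul_comp, C_comp, map_mul]
    simp only [map_pow]
    ring

theorem iteratedDeriv_rpow_eval (φ : ℝ[X]) (α : ℝ) (k : ℕ) {x : ℝ} (hx : 0 < φ.eval x) :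
    iteratedDeriv k (fun y => (φ.eval y) ^ α) x
      = (φ.eval x) ^ (α - k) * (derivPoly φ α k).eval x := by
  induction k generalizing x with
  | zero => simp [derivPoly]
  | succ k ih =>
    have hev : ∀ᶠ y in 𝓝 x, 0 < φ.eval y :=
      φ.continuous.continuousAt.eventually (lt_mem_nhds hx)
    have h1 : iteratedDeriv k (fun y => (φ.eval y) ^ α)
        =ᶠ[𝓝 x] fun y => (φ.eval y) ^ (α - k) * (derivPoly φ α k).eval y :=
      hev.mono fun y hy => ih hy
    rw [iteratedDeriv_succ, h1.deriv_eq]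
    have h2 := ((φ.hasDerivAt x).rpow_const (p := α - k) (Or.inl hx.ne')).mul
      ((derivPoly φ α k).hasDerivAt x)
    refine h2.deriv.trans ?_
    have h3 : (φ.eval x) ^ (α - k) = (φ.eval x) ^ (α - k - 1) * φ.eval x := by
      rw [← Real.rpow_add_one hx.ne']; ring_nf
    have h4 : α - ((k + 1 : ℕ) : ℝ) = α - k - 1 := by push_cast; ring
    simp only [derivPoly, eval_add, eval_mul, eval_C, h3, h4]
    ring

theorem contDiff_eval (p : ℝ[X]) (n : WithTop ℕ∞) : ContDiff ℝ n fun x => p.eval x := by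
  simpa using p.contDiff_aeval (𝕜 := ℝ) n

theorem contDiffAt_rpow_eval (φ : ℝ[X]) (α : ℝ) (n : WithTop ℕ∞) {x : ℝ} (hx : 0 < φ.eval x) :
    ContDiffAt ℝ n (fun y => (φ.eval y) ^ α) x :=
  ((contDiff_eval φ n).contDiffAt).rpow_const_of_ne hx.ne'

theorem expansionCoeff_rpow_eval (φ : ℝ[X]) (α : ℝ) (k : ℕ) (h0 : φ.eval 0 = 1) :
    expansionCoeff (fun y => (φ.eval y) ^ α) k = (derivPoly φ α k).eval 0 / (k.factorial : ℝ) := by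
  rw [expansionCoeff, iteratedDeriv_rpow_eval φ α k (by rw [h0]; exact one_pos), h0,
    Real.one_rpow, one_mul]

theorem exists_rat_expansionCoeff (φ : ℚ[X]) (α : ℚ) (k : ℕ) (h0 : φ.eval 0 = 1) :
    ∃ q : ℚ, expansionCoeff (fun y => ((φ.map (algebraMap ℚ ℝ)).eval y) ^ (α : ℝ)) k = (q : ℝ) := by
  refine ⟨(derivPoly φ α k).eval 0 / k.factorial, ?_⟩
  have h : (φ.map (algebraMap ℚ ℝ)).eval 0 = 1 := by
    rw [eval_zero_map, h0, map_one]
  rw [expansionCoeff_rpow_eval _ _ _ h]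
  have := derivPoly_map (algebraMap ℚ ℝ) φ α k
  rw [eq_ratCast] at this
  rw [← this, eval_zero_map]
  simp

/-! ### Power series expansions and the recurrences -/

/-- The Taylor series at `0` as a formal power series. -/
noncomputable def taylorSeries (f : ℝ → ℝ) : PowerSeries ℝ := PowerSeries.mk (expansionCoeff f)

theorem taylorSeries_mul {f g : ℝ → ℝ} (hf : ∀ n : ℕ, ContDiffAt ℝ n f 0)
    (hg : ∀ n : ℕ, ContDiffAt ℝ n g 0) :
    taylorSeries (fun x => f x * g x) = taylorSeries f * taylorSeries g := by
  ext n
  rw [PowerSeries.coeff_mul, taylorSeries, PowerSeries.coeff_mk, expansionCoeff,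
    iteratedDeriv_fun_mul (hf n) (hg n), Finset.Nat.sum_antidiagonal_eq_sum_range_succ_mk,
    Finset.sum_div]
  refine Finset.sum_congr rfl fun i hi => ?_
  have hi' : i ≤ n := Nat.lt_succ_iff.mp (Finset.mem_range.mp hi)
  have h := Nat.choose_mul_factorial_mul_factorial hi'
  have h' : (n.choose i : ℝ) * i.factorial * (n - i).factorial = n.factorial := by exact_mod_cast h
  simp only [taylorSeries, PowerSeries.coeff_mk, expansionCoeff]
  rw [← h']
  have := Nat.factorial_pos i
  have := Nat.factorial_pos (n - i)
  have := Nat.choose_pos hi'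
  field_simp

theorem taylorSeries_deriv (f : ℝ → ℝ) :
    taylorSeries (deriv f) = PowerSeries.derivative ℝ (taylorSeries f) := by
  ext n
  rw [PowerSeries.coeff_derivative]
  simp only [taylorSeries, PowerSeries.coeff_mk, expansionCoeff, ← iteratedDeriv_succ',
    Nat.factorial_succ]
  have := Nat.factorial_pos n
  push_cast
  field_simp

theorem taylorSeries_congr {f g : ℝ → ℝ} (h : f =ᶠ[𝓝 0] g) : taylorSeries f = taylorSeries g := by
  ext n
  simp only [taylorSeries, PowerSeries.coeff_mk, expansionCoeff, h.iteratedDeriv_eq n]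

theorem iteratedDeriv_eval (p : ℝ[X]) (n : ℕ) :
    iteratedDeriv n (fun x => p.eval x) = fun x => (derivative^[n] p).eval x := by
  induction n with
  | zero => simp
  | succ n ih =>
    rw [iteratedDeriv_succ, ih, Function.iterate_succ_apply']
    funext x
    exact (derivative^[n] p).deriv

theorem taylorSeries_eval (p : ℝ[X]) : taylorSeries (fun x => p.eval x) = (p : PowerSeries ℝ) := by
  ext n
  simp only [taylorSeries, PowerSeries.coeff_mk, expansionCoeff, iteratedDeriv_eval, coeff_coe]
  rw [← coeff_zero_eq_eval_zero, coeff_iterate_derivative]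
  have := Nat.factorial_pos n
  simp only [zero_add, Nat.descFactorial_self, nsmul_eq_mul]
  field_simp

/-- Raising the exponent by `j` multiplies by a polynomial, which brings the different powers of `φ`
in a recurrence to one and the same `h`. -/
theorem taylorSeries_rpow_shift (φ : ℝ[X]) (α : ℝ) (j : ℕ) (h0 : 0 < φ.eval 0) :
    taylorSeries (fun x => (φ.eval x) ^ (α + j))
      = ((φ ^ j : ℝ[X]) : PowerSeries ℝ) * taylorSeries (fun x => (φ.eval x) ^ α) := by
  rw [← taylorSeries_eval, ← taylorSeries_mul (fun n => (contDiff_eval (φ ^ j) n).contDiffAt)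
    (fun n => contDiffAt_rpow_eval φ α n h0)]
  refine taylorSeries_congr ?_
  filter_upwards [φ.continuous.continuousAt.eventually (lt_mem_nhds h0)] with y hy
  rw [Real.rpow_add hy, Real.rpow_natCast, eval_pow, mul_comm]

/-- The differential equation `φ h' = α φ' h` of `h = φ ^ α`. -/
theorem mul_derivative_taylorSeries_rpow (φ : ℝ[X]) (α : ℝ) (h0 : 0 < φ.eval 0) :
    (φ : PowerSeries ℝ) * PowerSeries.derivative ℝ (taylorSeries (fun x => (φ.eval x) ^ α))
      = ((C α * derivative φ : ℝ[X]) : PowerSeries ℝ) * taylorSeries (fun x => (φ.eval x) ^ α) := by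
  have h1 : taylorSeries (deriv fun x => (φ.eval x) ^ α)
      = ((C α * derivative φ : ℝ[X]) : PowerSeries ℝ)
        * taylorSeries (fun x => (φ.eval x) ^ (α - 1)) := by
    rw [← taylorSeries_eval, ← taylorSeries_mul
      (fun n => (contDiff_eval (C α * derivative φ) n).contDiffAt)
      (fun n => contDiffAt_rpow_eval φ (α - 1) n h0)]
    refine taylorSeries_congr ?_
    filter_upwards [φ.continuous.continuousAt.eventually (lt_mem_nhds h0)] with y hy
    rw [((φ.hasDerivAt y).rpow_const (p := α) (Or.inl hy.ne')).deriv]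
    simp only [eval_mul, eval_C]
    ring
  have h2 := taylorSeries_rpow_shift φ (α - 1) 1 h0
  rw [Nat.cast_one, sub_add_cancel, pow_one] at h2
  rw [← taylorSeries_deriv, h1, h2]
  ring

/-- Vanishing of the residue of a derivative, in terms of coefficients: if
`L h = x (φ Q h)' - N φ Q h`, then `[x^N] (L h) = 0`. The hypothesis on `L` is this equation after
eliminating `h'` by the differential equation of `h`. -/
theorem coeff_mul_eq_zero_of_certificate (φ Q L : ℝ[X]) (α : ℝ) (N : ℕ) (H : PowerSeries ℝ)
    (hH : (φ : PowerSeries ℝ) * PowerSeries.derivative ℝ H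
      = ((C α * derivative φ : ℝ[X]) : PowerSeries ℝ) * H)
    (hL : L = X * (C (α + 1) * derivative φ * Q + φ * derivative Q) - C (N : ℝ) * φ * Q) :
    PowerSeries.coeff N ((L : PowerSeries ℝ) * H) = 0 := by
  have key : (L : PowerSeries ℝ) * H = PowerSeries.X *
      PowerSeries.derivative ℝ (((φ * Q : ℝ[X]) : PowerSeries ℝ) * H)
        - PowerSeries.C (N : ℝ) * (((φ * Q : ℝ[X]) : PowerSeries ℝ) * H) := by
    rw [Derivation.leibniz, PowerSeries.derivative_coe, hL]
    simp only [smul_eq_mul, derivative_mul, coe_mul, coe_add, coe_sub, coe_X, coe_C, map_add,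
      map_one, add_mul, one_mul] at hH ⊢
    linear_combination (-(PowerSeries.X : PowerSeries ℝ)) * (Q : PowerSeries ℝ) * hH
  rw [key, map_sub, PowerSeries.coeff_C_mul]
  cases N with
  | zero => simp
  | succ N =>
    rw [PowerSeries.coeff_succ_X_mul, PowerSeries.coeff_derivative]
    push_cast
    ring

/-! ### The coefficients of the two series -/

/-- The polynomial `(1 + y)(1 + 2y)` of the series `ω_B`. -/
noncomputable def phiB (K : Type*) [Field K] : K[X] := (1 + X) * (1 + C 2 * X)

/-- The polynomial `(1 + y)(1 + 2y)(1 + 3y)(1 + 3y/2)` of the series `ω_G`. -/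
noncomputable def phiG (K : Type*) [Field K] : K[X] :=
  (1 + X) * (1 + C 2 * X) * (1 + C 3 * X) * (1 + C (3 / 2) * X)

theorem bCoeff_eq_expansionCoeff (n : ℕ) :
    bCoeff n = expansionCoeff (fun x => ((phiB ℝ).eval x) ^ (((n : ℝ) - 1) / 3)) n := by
  simp [bCoeff, phiB]

theorem gCoeff_eq_expansionCoeff (n : ℕ) :
    gCoeff n = expansionCoeff (fun x => ((phiG ℝ).eval x) ^ (((n : ℝ) - 1) / 5)) n := by
  simp [gCoeff, phiG]

theorem exists_rat_bCoeff (n : ℕ) : ∃ q : ℚ, bCoeff n = (q : ℝ) := by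
  have h := exists_rat_expansionCoeff (phiB ℚ) (((n : ℚ) - 1) / 3) n (by simp [phiB])
  have hm : (phiB ℚ).map (algebraMap ℚ ℝ) = phiB ℝ := by simp [phiB]
  rw [hm] at h
  rw [bCoeff_eq_expansionCoeff]
  exact_mod_cast h

theorem exists_rat_gCoeff (n : ℕ) : ∃ q : ℚ, gCoeff n = (q : ℝ) := by
  have h := exists_rat_expansionCoeff (phiG ℚ) (((n : ℚ) - 1) / 5) n (by simp [phiG])
  have hm : (phiG ℚ).map (algebraMap ℚ ℝ) = phiG ℝ := by simp [phiG]
  rw [hm] at h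
  rw [gCoeff_eq_expansionCoeff]
  exact_mod_cast h

/-- The certificate `Q` of the recurrence of `b_n`. With `h = phiB ^ ((n - 1) / 3)` the numbers
`b_{n+6}` and `b_n` are the coefficients of `x ^ (n + 6)` in `phiB ^ 2 h` and `x ^ 6 h`; the
combination of these two functions with the weights of the recurrence equals
`x (phiB Q h)' - (n + 6) phiB Q h`. This is a linear system for the
coefficients of `Q`. -/
noncomputable def certB (n : ℝ) : ℝ[X] :=
  C (-108 - 27 * n) +
    C (-432 - 108 * n) * X +
    C (-450 - 117 * n) * X ^ 2 +
    C (-36 - 18 * n) * X ^ 3 +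
    C (30 + 6 * n) * X ^ 4

theorem certB_spec (n : ℝ) :
    C (27 * (n + 4) * (n + 6)) * phiB ℝ ^ 2 - C (4 * (n + 2) * (n + 5)) * X ^ 6
      = X * (C ((n - 1) / 3 + 1) * derivative (phiB ℝ) * certB n + phiB ℝ * derivative (certB n))
        - C (n + 6) * phiB ℝ * certB n := by
  refine Polynomial.funext fun x => ?_
  simp only [certB, phiB, derivative_add, derivative_mul, derivative_C, derivative_X_pow,
    derivative_X, derivative_one, eval_add, eval_sub, eval_mul, eval_pow, eval_C, eval_X, eval_one,
    eval_zero]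
  push_cast
  ring

theorem bCoeff_recurrence (n : ℕ) :
    27 * ((n : ℝ) + 4) * ((n : ℝ) + 6) * bCoeff (n + 6)
      - 4 * ((n : ℝ) + 2) * ((n : ℝ) + 5) * bCoeff n = 0 := by
  have h0 : 0 < (phiB ℝ).eval 0 := by simp [phiB]
  have key := coeff_mul_eq_zero_of_certificate (phiB ℝ) (certB n) _ (((n : ℝ) - 1) / 3) (n + 6) _
    (mul_derivative_taylorSeries_rpow (phiB ℝ) (((n : ℝ) - 1) / 3) h0)
    (by have := certB_spec n; push_cast; exact this)
  have h6 := taylorSeries_rpow_shift (phiB ℝ) (((n : ℝ) - 1) / 3) 2 h0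
  have e6 : bCoeff (n + 6) = PowerSeries.coeff (n + 6)
      (taylorSeries fun x => ((phiB ℝ).eval x) ^ (((n : ℝ) - 1) / 3 + (2 : ℕ))) := by
    have hn : (((n + 6 : ℕ) : ℝ) - 1) / 3 = ((n : ℝ) - 1) / 3 + (2 : ℕ) := by
      push_cast
      ring
    rw [bCoeff_eq_expansionCoeff, taylorSeries, PowerSeries.coeff_mk, hn]
  have e0 : bCoeff n = PowerSeries.coeff n
      (taylorSeries fun x => ((phiB ℝ).eval x) ^ (((n : ℝ) - 1) / 3)) := by
    rw [bCoeff_eq_expansionCoeff, taylorSeries, PowerSeries.coeff_mk]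
  rw [e6, e0, h6, ← PowerSeries.coeff_X_pow_mul _ 6 n]
  rw [← key]
  simp only [coe_sub, coe_mul, coe_pow, coe_C, coe_X, sub_mul, map_sub, mul_assoc,
    PowerSeries.coeff_C_mul]

/-- The certificate of the recurrence of `g_n`, with the same role as `certB`, for the coefficients
of `x ^ (n + 20)` in `phiG ^ 4 h`, `x ^ 10 phiG ^ 2 h` and `x ^ 20 h`, where
`h = phiG ^ ((n - 1) / 5)`. -/
noncomputable def certG (n : ℝ) : ℝ[X] :=
  C (1 / 2) * (C (-14860800000 - 5066400000 * n - 615400000 * n ^ 2 +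
        (-31900000) * n ^ 3 - 600000 * n ^ 4) +
    C (-356659200000 - 121593600000 * n - 14769600000 * n ^ 2 - 765600000 * n ^ 3 +
        (-14400000) * n ^ 4) * X +
    C (-3885273600000 - 1324628000000 * n - 160906000000 * n ^ 2 +
        (-8341250000) * n ^ 3 - 156900000 * n ^ 4) * X ^ 2 +
    C (-25416921600000 - 8666196000000 * n - 1052814000000 * n ^ 2 +
        (-54584250000) * n ^ 3 - 1026900000 * n ^ 4) * X ^ 3 +
    C (-111295106040000 - 37952313340000 * n - 4611452222500 * n ^ 2 +
        (-239138733750) * n ^ 3 - 4500157500 * n ^ 4) * X ^ 4 +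
    C (-343999563120000 - 117329920920000 * n - 14260262805000 * n ^ 2 +
        (-739758757500) * n ^ 3 - 13926735000 * n ^ 4) * X ^ 5 +
    C (-770638154220000 - 262928064300000 * n - 31969615906250 * n ^ 2 +
        (-1659311637500) * n ^ 3 - 31257930000 * n ^ 4) * X ^ 6 +
    C (-1263099152700000 - 431153850600000 * n - 52457908181250 * n ^ 2 +
        (-2724885693750) * n ^ 3 - 51379762500 * n ^ 4) * X ^ 7 +
    C (-1507161858088500 - 514853965752625 * n - 62704733797625 * n ^ 2 +
        (-3261211088500) * n ^ 3 - 61582591500 * n ^ 4) * X ^ 8 +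
    C (-1281616826382000 - 438357623551500 * n - 53476966239000 * n ^ 2 +
        (-2786963232000) * n ^ 3 - 52751808000 * n ^ 4) * X ^ 9 +
    C (-741487815374250 - 254186146619375 * n - 31101137949125 * n ^ 2 +
        (-1626702943500) * n ^ 3 - 30917857500 * n ^ 4) * X ^ 10 +
    C (-264455259635250 - 91076550742125 * n - 11211475579875 * n ^ 2 +
        (-590731629750) * n ^ 3 - 11321613000 * n ^ 4) * X ^ 11 +
    C (-44163190953600 - 15418222528275 * n - 1931907849825 * n ^ 2 +
        (-103996435500) * n ^ 3 - 2041170300 * n ^ 4) * X ^ 12 +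
    C (1226778348150 + 353582885475 * n + 32155848675 * n ^ 2 + 921280500 * n ^ 3 +
        299700 * n ^ 4) * X ^ 13 +
    C (931095949050 + 317032352325 * n + 38416077225 * n ^ 2 + 1970298000 * n ^ 3 +
        36360900 * n ^ 4) * X ^ 14 +
    C (443847600 + 191880900 * n + 25105950 * n ^ 2 + 1316250 * n ^ 3 + 24300 * n ^ 4) * X ^ 15 +
    C (-199731420 - 58605930 * n - 6240240 * n ^ 2 - 287550 * n ^ 3 +
        (-4860) * n ^ 4) * X ^ 16)

theorem certG_spec (n : ℝ) :
    C (729 * (n + 4) * (n + 9) * (n + 14) * (n + 19) * (6 * n + 103)) * X ^ 20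
      - C (1875 * (n + 14) * (n + 19) * (216 * n ^ 3 + 7596 * n ^ 2 + 83694 * n + 290603))
        * (X ^ 10 * phiG ℝ ^ 2)
      + C (50000 * (n + 12) * (n + 16) * (n + 18) * (n + 20) * (6 * n + 43)) * phiG ℝ ^ 4
      = X * (C ((n - 1) / 5 + 1) * derivative (phiG ℝ) * certG n + phiG ℝ * derivative (certG n))
        - C (n + 20) * phiG ℝ * certG n := by
  refine Polynomial.funext fun x => ?_
  simp only [certG, phiG, derivative_add, derivative_mul, derivative_C, derivative_X_pow,
    derivative_X, derivative_one, eval_add, eval_sub, eval_mul, eval_pow, eval_C, eval_X, eval_one,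
    eval_zero]
  push_cast
  ring

theorem gCoeff_recurrence (n : ℕ) :
    729 * ((n : ℝ) + 4) * ((n : ℝ) + 9) * ((n : ℝ) + 14) * ((n : ℝ) + 19)
        * (6 * (n : ℝ) + 103) * gCoeff n
      - 1875 * ((n : ℝ) + 14) * ((n : ℝ) + 19)
        * (216 * (n : ℝ) ^ 3 + 7596 * (n : ℝ) ^ 2 + 83694 * (n : ℝ) + 290603)
        * gCoeff (n + 10)
      + 50000 * ((n : ℝ) + 12) * ((n : ℝ) + 16) * ((n : ℝ) + 18) * ((n : ℝ) + 20)
        * (6 * (n : ℝ) + 43) * gCoeff (n + 20) = 0 := by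
  have h0 : 0 < (phiG ℝ).eval 0 := by simp [phiG]
  have key := coeff_mul_eq_zero_of_certificate (phiG ℝ) (certG n) _ (((n : ℝ) - 1) / 5) (n + 20) _
    (mul_derivative_taylorSeries_rpow (phiG ℝ) (((n : ℝ) - 1) / 5) h0)
    (by have := certG_spec n; push_cast; exact this)
  have h10 := taylorSeries_rpow_shift (phiG ℝ) (((n : ℝ) - 1) / 5) 2 h0
  have h20 := taylorSeries_rpow_shift (phiG ℝ) (((n : ℝ) - 1) / 5) 4 h0
  have e20 : gCoeff (n + 20) = PowerSeries.coeff (n + 20)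
      (taylorSeries fun x => ((phiG ℝ).eval x) ^ (((n : ℝ) - 1) / 5 + (4 : ℕ))) := by
    have hn : (((n + 20 : ℕ) : ℝ) - 1) / 5 = ((n : ℝ) - 1) / 5 + (4 : ℕ) := by
      push_cast
      ring
    rw [gCoeff_eq_expansionCoeff, taylorSeries, PowerSeries.coeff_mk, hn]
  have e10 : gCoeff (n + 10) = PowerSeries.coeff (n + 10)
      (taylorSeries fun x => ((phiG ℝ).eval x) ^ (((n : ℝ) - 1) / 5 + (2 : ℕ))) := by
    have hn : (((n + 10 : ℕ) : ℝ) - 1) / 5 = ((n : ℝ) - 1) / 5 + (2 : ℕ) := by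
      push_cast
      ring
    rw [gCoeff_eq_expansionCoeff, taylorSeries, PowerSeries.coeff_mk, hn]
  have e0 : gCoeff n = PowerSeries.coeff n
      (taylorSeries fun x => ((phiG ℝ).eval x) ^ (((n : ℝ) - 1) / 5)) := by
    rw [gCoeff_eq_expansionCoeff, taylorSeries, PowerSeries.coeff_mk]
  rw [e20, e10, e0, h20, h10, ← PowerSeries.coeff_X_pow_mul _ 20 n,
    ← PowerSeries.coeff_X_pow_mul _ 10 (n + 10)]
  rw [← key]
  simp only [coe_sub, coe_add, coe_mul, coe_pow, coe_C, coe_X, sub_mul, add_mul, map_sub, map_add,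
    mul_assoc, PowerSeries.coeff_C_mul]

/-! ### Simple poles, the identity theorem and gluing -/

/-- Near `z` (but not at `z`) the function `f` is `g s / (s - z)` with `g` analytic at `z` and
`g z = r`: the point is a simple pole with residue `r`, or `r = 0` and it is removable. -/
def HasSimplePoleAt (f : ℂ → ℂ) (z r : ℂ) : Prop :=
  ∃ g : ℂ → ℂ, AnalyticAt ℂ g z ∧ g z = r ∧ f =ᶠ[𝓝[≠] z] fun s => g s / (s - z)

namespace HasSimplePoleAt

variable {f f₁ f₂ : ℂ → ℂ} {z r r₁ r₂ : ℂ}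

theorem of_analyticAt (hf : AnalyticAt ℂ f z) : HasSimplePoleAt f z 0 := by
  refine ⟨fun s => (s - z) * f s, by fun_prop, by simp, ?_⟩
  filter_upwards [self_mem_nhdsWithin] with s hs
  have : s - z ≠ 0 := sub_ne_zero.mpr hs
  field_simp

theorem add (h₁ : HasSimplePoleAt f₁ z r₁) (h₂ : HasSimplePoleAt f₂ z r₂) :
    HasSimplePoleAt (fun s => f₁ s + f₂ s) z (r₁ + r₂) := by
  obtain ⟨g₁, ha₁, rfl, he₁⟩ := h₁
  obtain ⟨g₂, ha₂, rfl, he₂⟩ := h₂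
  refine ⟨fun s => g₁ s + g₂ s, by fun_prop, rfl, ?_⟩
  filter_upwards [he₁, he₂] with s h₁ h₂
  rw [h₁, h₂, add_div]

theorem mul_analyticAt {a : ℂ → ℂ} (h : HasSimplePoleAt f z r) (ha : AnalyticAt ℂ a z) :
    HasSimplePoleAt (fun s => a s * f s) z (a z * r) := by
  obtain ⟨g, hg, rfl, he⟩ := h
  refine ⟨fun s => a s * g s, by fun_prop, rfl, ?_⟩
  filter_upwards [he] with s h
  rw [h, mul_div_assoc]

theorem congr (h : HasSimplePoleAt f₁ z r) (he : f₂ =ᶠ[𝓝[≠] z] f₁) : HasSimplePoleAt f₂ z r := by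
  obtain ⟨g, hg, hr, h⟩ := h
  exact ⟨g, hg, hr, he.trans h⟩

theorem sum {ι : Type*} (S : Finset ι) {F : ι → ℂ → ℂ} (h : ∀ i ∈ S, HasSimplePoleAt (F i) z 0) :
    HasSimplePoleAt (fun s => ∑ i ∈ S, F i s) z 0 := by
  classical
  induction S using Finset.induction_on with
  | empty => simpa using of_analyticAt (z := z) (f := fun _ => 0) analyticAt_const
  | insert i S hi ih =>
    simp only [Finset.sum_insert hi]
    simpa using (h i (by simp)).add (ih fun j hj => h j (by simp [hj]))

theorem hasResidueAt (h : HasSimplePoleAt f z r) : HasResidueAt f z r := by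
  obtain ⟨g, hg, hr, he⟩ := h
  refine ⟨?_, ?_⟩
  · have : MeromorphicAt (fun s => g s / (s - z)) z :=
      hg.meromorphicAt.div (by fun_prop)
    exact this.congr he.symm
  · rw [eventuallyEq_nhdsWithin_iff] at he
    obtain ⟨ε, hε, hball⟩ := Metric.eventually_nhds_iff_ball.mp
      (he.and hg.eventually_analyticAt)
    filter_upwards [Ioo_mem_nhdsGT hε] with ρ hρ
    have h1 : (∮ w in C(z, ρ), f w) = ∮ w in C(z, ρ), (w - z)⁻¹ • g w := by
      refine circleIntegral.integral_congr hρ.1.le fun w hw => ?_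
      have hw' : w ∈ Metric.ball z ε := by
        rw [Metric.mem_ball, Metric.mem_sphere.mp hw]; exact hρ.2
      have hne : w ≠ z := by
        rintro rfl
        simp only [Metric.mem_sphere, dist_self] at hw
        exact hρ.1.ne hw
      simp only [(hball w hw').1 hne, smul_eq_mul, div_eq_inv_mul]
    have h2 : DiffContOnCl ℂ g (Metric.ball z ρ) := by
      refine DifferentiableOn.diffContOnCl_ball (U := Metric.ball z ε) ?_
        (Metric.closedBall_subset_ball hρ.2)
      exact fun w hw => (hball w hw).2.differentiableAt.differentiableWithinAt
    rw [h1, h2.circleIntegral_sub_inv_smul (Metric.mem_ball_self hρ.1), hr, smul_eq_mul,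
      inv_mul_cancel_left₀ Complex.two_pi_I_ne_zero]

end HasSimplePoleAt

/-- `(s - 1) ζ(s)`, an entire function; the value at `s = 1` is the residue of `ζ`. -/
noncomputable def zetaReg : ℂ → ℂ :=
  Function.update (fun s => (s - 1) * riemannZeta s) 1 1

theorem analyticAt_zetaReg (z : ℂ) : AnalyticAt ℂ zetaReg z := by
  by_cases hz : z = 1
  · subst hz
    refine Complex.analyticAt_of_differentiable_on_punctured_nhds_of_continuousAt ?_ ?_
    · filter_upwards [self_mem_nhdsWithin] with w hw
      have h1 : DifferentiableAt ℂ (fun s => (s - 1) * riemannZeta s) w :=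
        (by fun_prop : DifferentiableAt ℂ (fun s : ℂ => s - 1) w).mul
          (differentiableAt_riemannZeta hw)
      refine h1.congr_of_eventuallyEq ?_
      filter_upwards [isOpen_ne.mem_nhds hw] with v hv
      exact Function.update_of_ne hv _ _
    · rw [zetaReg, continuousAt_update_same]
      exact riemannZeta_residue_one
  · have hd : DifferentiableOn ℂ zetaReg {1}ᶜ := by
      intro w hw
      have h1 : DifferentiableAt ℂ (fun s => (s - 1) * riemannZeta s) w :=
        (by fun_prop : DifferentiableAt ℂ (fun s : ℂ => s - 1) w).mul
          (differentiableAt_riemannZeta hw)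
      refine (h1.congr_of_eventuallyEq ?_).differentiableWithinAt
      filter_upwards [isOpen_ne.mem_nhds hw] with v hv
      exact Function.update_of_ne hv _ _
    exact hd.analyticAt (isOpen_ne.mem_nhds hz)

theorem zetaReg_one : zetaReg 1 = 1 := Function.update_self _ _ _

theorem riemannZeta_eq_zetaReg_div {s : ℂ} (hs : s ≠ 1) : riemannZeta s = zetaReg s / (s - 1) := by
  rw [zetaReg, Function.update_of_ne hs, mul_div_cancel_left₀ _ (sub_ne_zero.mpr hs)]

theorem analyticAt_riemannZeta {z : ℂ} (hz : z ≠ 1) : AnalyticAt ℂ riemannZeta z := by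
  have hd : DifferentiableOn ℂ riemannZeta {1}ᶜ := fun w hw =>
    (differentiableAt_riemannZeta hw).differentiableWithinAt
  exact hd.analyticAt (isOpen_ne.mem_nhds hz)

/-- `ζ(D s + k)` is meromorphic, with a simple pole of residue `1 / D` where `D s + k = 1`. -/
theorem hasSimplePoleAt_riemannZeta_affine {D k z : ℂ} (hD : D ≠ 0) (hz : D * z + k = 1) :
    HasSimplePoleAt (fun s => riemannZeta (D * s + k)) z (1 / D) := by
  refine ⟨fun s => zetaReg (D * s + k) / D, ?_, by simp only [hz, zetaReg_one], ?_⟩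
  · exact ((analyticAt_zetaReg _).fun_comp (g := zetaReg) (f := fun s => D * s + k)
      (by fun_prop)).div_const
  · filter_upwards [self_mem_nhdsWithin] with s hs
    have h1 : D * s + k - 1 = D * (s - z) := by rw [← hz]; ring
    have h2 : s - z ≠ 0 := sub_ne_zero.mpr hs
    have h3 : D * s + k ≠ 1 := by
      intro h
      rw [h, sub_self] at h1
      exact mul_ne_zero hD h2 h1.symm
    rw [riemannZeta_eq_zetaReg_div h3, h1, div_div]

theorem analyticAt_riemannZeta_affine {D k z : ℂ} (hz : D * z + k ≠ 1) :
    AnalyticAt ℂ (fun s => riemannZeta (D * s + k)) z :=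
  (analyticAt_riemannZeta hz).fun_comp (g := riemannZeta) (f := fun s => D * s + k) (by fun_prop)

theorem meromorphicAt_riemannZeta_affine {D : ℂ} (hD : D ≠ 0) (k z : ℂ) :
    MeromorphicAt (fun s => riemannZeta (D * s + k)) z := by
  by_cases hz : D * z + k = 1
  · exact (hasSimplePoleAt_riemannZeta_affine hD hz).hasResidueAt.1
  · exact (analyticAt_riemannZeta_affine hz).meromorphicAt

/-- Identity theorem for meromorphic functions on a connected open set meeting a half-plane. -/
theorem MeromorphicOn.eventuallyEq_of_eq_halfPlane {f g : ℂ → ℂ} {U : Set ℂ}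
    (hU : IsPreconnected U) (hUo : IsOpen U) (hf : MeromorphicOn f U) (hg : MeromorphicOn g U)
    {σ : ℝ} {x : ℂ} (hx : x ∈ U) (hσ : σ < x.re) (h : ∀ s ∈ U, σ < s.re → f s = g s)
    {z : ℂ} (hz : z ∈ U) : f =ᶠ[𝓝[≠] z] g := by
  have hfg : MeromorphicOn (f - g) U := hf.sub hg
  have hxt : meromorphicOrderAt (f - g) x = ⊤ := by
    rw [meromorphicOrderAt_eq_top_iff]
    refine eventually_nhdsWithin_of_eventually_nhds ?_
    filter_upwards [hUo.mem_nhds hx,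
      (isOpen_lt continuous_const Complex.continuous_re).mem_nhds hσ] with s hs hs'
    simp [h s hs hs']
  have hzt : meromorphicOrderAt (f - g) z = ⊤ := by
    by_contra hne
    exact hfg.meromorphicOrderAt_ne_top_of_isPreconnected hU hz hx hne hxt
  rw [meromorphicOrderAt_eq_top_iff] at hzt
  filter_upwards [hzt] with s hs
  exact sub_eq_zero.mp hs

/-- Meromorphic continuations to arbitrarily large discs glue to one on the plane. -/
theorem exists_isMeromorphicContinuation {term : ℂ → ℕ+ × ℕ+ → ℂ} {σ : ℝ}
    (h : ∀ M : ℕ, ∃ Ω : ℂ → ℂ, MeromorphicOn Ω (Metric.ball 0 M) ∧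
      ∀ s ∈ Metric.ball (0 : ℂ) M, σ < s.re → HasSum (term s) (Ω s)) :
    ∃ Ω : ℂ → ℂ, IsMeromorphicContinuation term σ Ω := by
  choose Ω hΩ hsum using h
  -- from the radius `M₀` on, the discs meet the half-plane of convergence
  obtain ⟨M₀, hM₀⟩ := exists_nat_gt (|σ| + 1)
  have hagree : ∀ M N : ℕ, M₀ ≤ M → M ≤ N → ∀ z ∈ Metric.ball (0 : ℂ) M,
      Ω N =ᶠ[𝓝[≠] z] Ω M := by
    intro M N hM hMN z hz
    have hsub : Metric.ball (0 : ℂ) M ⊆ Metric.ball 0 N :=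
      Metric.ball_subset_ball (by exact_mod_cast hMN)
    refine MeromorphicOn.eventuallyEq_of_eq_halfPlane (U := Metric.ball 0 M)
      (convex_ball _ _).isPreconnected Metric.isOpen_ball
      (fun w hw => hΩ N w (hsub hw)) (hΩ M) (σ := σ) (x := ((|σ| + 1 : ℝ) : ℂ)) ?_ ?_ ?_ hz
    · rw [mem_ball_zero_iff, Complex.norm_real, Real.norm_of_nonneg (by positivity)]
      exact hM₀.trans_le (by exact_mod_cast hM)
    · rw [Complex.ofReal_re]; linarith [le_abs_self σ]
    · exact fun s hs hre => (hsum N s (hsub hs) hre).unique (hsum M s hs hre)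
  let N : ℂ → ℕ := fun s => ⌈‖s‖⌉₊ + 1 + M₀
  have hN : ∀ s, s ∈ Metric.ball (0 : ℂ) (N s) := by
    intro s
    rw [mem_ball_zero_iff]
    have := Nat.le_ceil ‖s‖
    have h0 : (0 : ℝ) ≤ M₀ := Nat.cast_nonneg _
    push_cast [N]
    linarith
  refine ⟨fun s => Ω (N s) s, fun z => ?_, fun s hs => hsum _ s (hN s) hs⟩
  -- near `z` only finitely many of the discs are used
  have hfin : ∀ᶠ s in 𝓝[≠] z, ∀ k ∈ Finset.range (N z + 2), N z ≤ k → Ω k s = Ω (N z) s := by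
    rw [eventually_all_finset]
    intro k _
    by_cases hk : N z ≤ k
    · filter_upwards [hagree (N z) k (by simp [N]) hk z (hN z)] with s hs _ using hs
    · exact Eventually.of_forall fun s hk' => absurd hk' hk
  have hfin' : ∀ᶠ s in 𝓝[≠] z, ∀ k ∈ Finset.range (N z + 2), M₀ ≤ k → k ≤ N z →
      z ∈ Metric.ball (0 : ℂ) k → Ω (N z) s = Ω k s := by
    rw [eventually_all_finset]
    intro k _
    by_cases hk : M₀ ≤ k ∧ k ≤ N z ∧ z ∈ Metric.ball (0 : ℂ) k
    · filter_upwards [hagree k (N z) hk.1 hk.2.1 z hk.2.2] with s hs _ _ _ using hs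
    · exact Eventually.of_forall fun s h1 h2 h3 => absurd ⟨h1, h2, h3⟩ hk
  refine (hΩ (N z) z (hN z)).congr ?_
  have hnear : ∀ᶠ s in 𝓝[≠] z, dist s z < 1 :=
    eventually_nhdsWithin_of_eventually_nhds (Metric.ball_mem_nhds z one_pos)
  filter_upwards [hfin, hfin', hnear] with s h1 h2 h3
  have h4 : ‖s‖ < ‖z‖ + 1 := by
    have := norm_sub_norm_le s z
    rw [← dist_eq_norm] at this; linarith
  have h5 : ‖z‖ < ‖s‖ + 1 := by
    have := norm_sub_norm_le z s
    rw [← dist_eq_norm, dist_comm] at this; linarith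
  have h6 : N s < N z + 2 := by
    have : ⌈‖s‖⌉₊ ≤ ⌈‖z‖⌉₊ + 1 := by
      rw [Nat.ceil_le]; push_cast
      linarith [Nat.le_ceil ‖z‖]
    simp only [N]; omega
  rcases le_total (N z) (N s) with hle | hle
  · exact (h1 _ (Finset.mem_range.mpr h6) hle).symm
  · refine h2 _ (Finset.mem_range.mpr h6) (by simp [N]) hle ?_
    rw [mem_ball_zero_iff]
    have := Nat.le_ceil ‖s‖
    have h0 : (0 : ℝ) ≤ M₀ := Nat.cast_nonneg _
    push_cast [N]
    linarith

/-! ### Holomorphic dependence of integrals on a parameter -/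

open MeasureTheory in
/-- An integral of functions that are holomorphic in a parameter and have a common integrable bound
is holomorphic in the parameter; Cauchy's estimate bounds the derivatives. -/
theorem differentiableAt_integral_of_bound {α : Type*} [MeasurableSpace α] {μ : Measure α}
    {F : ℂ → α → ℂ} {z : ℂ} {R : ℝ} (hR : 0 < R) {bound : α → ℝ}
    (hm : ∀ s ∈ Metric.ball z R, AEStronglyMeasurable (F s) μ)
    (hd : ∀ᵐ x ∂μ, DifferentiableOn ℂ (fun s => F s x) (Metric.ball z R))
    (hb : ∀ᵐ x ∂μ, ∀ s ∈ Metric.ball z R, ‖F s x‖ ≤ bound x) (hbi : Integrable bound μ) :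
    DifferentiableAt ℂ (fun s => ∫ x, F s x ∂μ) z := by
  have hz : z ∈ Metric.ball z R := Metric.mem_ball_self hR
  have hdz : ∀ᵐ x ∂μ, ∀ s ∈ Metric.ball z (R / 2),
      HasDerivAt (fun s => F s x) (deriv (fun s => F s x) s) s := by
    filter_upwards [hd] with x hx s hs
    refine (hx.differentiableAt (Metric.isOpen_ball.mem_nhds ?_)).hasDerivAt
    exact Metric.ball_subset_ball (by linarith) hs
  refine (hasDerivAt_integral_of_dominated_loc_of_deriv_le (F := F)
    (F' := fun s x => deriv (fun s => F s x) s) (bound := fun x => bound x / (R / 4))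
    (s := Metric.ball z (R / 2)) (Metric.ball_mem_nhds z (by linarith)) ?_ ?_ ?_ ?_ ?_
    hdz).2.differentiableAt
  · filter_upwards [Metric.ball_mem_nhds z hR] with s hs using hm s hs
  · exact hbi.mono' (hm z hz) (hb.mono fun x hx => hx z hz)
  · -- the derivative is measurable as a limit of difference quotients along the sequence `u`
    let u : ℕ → ℂ := fun n => ((R / 2 : ℝ) : ℂ) * (1 / ((n : ℂ) + 1))
    have hu0 : Tendsto u atTop (𝓝 0) := by
      have := (tendsto_one_div_add_atTop_nhds_zero_nat (𝕜 := ℂ)).const_mul ((R / 2 : ℝ) : ℂ)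
      rwa [mul_zero] at this
    have hune : ∀ n, u n ≠ 0 := fun n =>
      mul_ne_zero (by exact_mod_cast (by linarith : R / 2 ≠ 0))
        (one_div_ne_zero (Nat.cast_add_one_ne_zero n))
    have hub : ∀ n, z + u n ∈ Metric.ball z R := by
      intro n
      rw [Metric.mem_ball, dist_eq_norm, add_sub_cancel_left, norm_mul, Complex.norm_real,
        Real.norm_of_nonneg (by linarith), norm_div, norm_one]
      have h1 : (1 : ℝ) ≤ ‖(n : ℂ) + 1‖ := by
        have : ((n : ℂ) + 1) = ((n + 1 : ℕ) : ℂ) := by push_cast; ring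
        rw [this, Complex.norm_natCast]
        exact_mod_cast Nat.le_add_left 1 n
      have h2 : 1 / ‖(n : ℂ) + 1‖ ≤ 1 := by
        rw [div_le_one (by linarith)]; exact h1
      nlinarith
    refine aestronglyMeasurable_of_tendsto_ae (f := fun n x => (u n)⁻¹ • (F (z + u n) x - F z x))
      atTop (fun n => ((hm _ (hub n)).sub (hm z hz)).const_smul (u n)⁻¹) ?_
    filter_upwards [hdz] with x hx
    have := hasDerivAt_iff_tendsto_slope_zero.mp (hx z (Metric.mem_ball_self (by linarith)))
    refine this.comp (tendsto_nhdsWithin_iff.mpr ⟨hu0, Eventually.of_forall fun n => hune n⟩)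
  · filter_upwards [hd, hb] with x hx hbx s hs
    have hsub : Metric.closedBall s (R / 4) ⊆ Metric.ball z R := by
      intro w hw
      rw [Metric.mem_closedBall] at hw
      rw [Metric.mem_ball] at hs ⊢
      linarith [dist_triangle w s z]
    refine Complex.norm_deriv_le_of_forall_mem_sphere_norm_le (by linarith)
      (hx.diffContOnCl_ball hsub) fun w hw => hbx w (hsub (Metric.sphere_subset_closedBall hw))
  · exact hbi.div_const _

/-! ### Euler–Maclaurin summation -/

/-- The coefficients of the boundary terms in the Euler–Maclaurin formula, indexed so that `k = 0`
belongs to the antiderivative of the summand. The coefficient of the summand itself is `0`, because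
its values at the endpoints are averaged. -/
noncomputable def eulerMaclaurinCoeff (k : ℕ) : ℂ :=
  if k = 1 then 0 else (-1) ^ k * ((bernoulliFun k 0 : ℝ) : ℂ) / (k.factorial : ℂ)

/-- The remainder integral of the Euler–Maclaurin formula on `[a, a + 1]`. -/
noncomputable def eulerMaclaurinRem (K : ℕ) (h : ℝ → ℂ) (a : ℝ) : ℂ :=
  ∫ t in (0 : ℝ)..1, ((bernoulliFun K t : ℝ) : ℂ) / (K.factorial : ℂ) * h (a + t)

theorem eulerMaclaurinRem_succ {K : ℕ} {h h' : ℝ → ℂ} {a : ℝ}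
    (hd : ∀ x ∈ Set.Icc a (a + 1), HasDerivAt h (h' x) x)
    (hc : ContinuousOn h' (Set.Icc a (a + 1))) :
    eulerMaclaurinRem (K + 1) h' a
      = ((bernoulliFun (K + 1) 1 : ℝ) : ℂ) / ((K + 1).factorial : ℂ) * h (a + 1)
        - ((bernoulliFun (K + 1) 0 : ℝ) : ℂ) / ((K + 1).factorial : ℂ) * h a
        - eulerMaclaurinRem K h a := by
  have hmem : ∀ t ∈ Set.uIcc (0 : ℝ) 1, a + t ∈ Set.Icc a (a + 1) := by
    intro t ht
    rw [Set.uIcc_of_le zero_le_one] at ht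
    exact ⟨by linarith [ht.1], by linarith [ht.2]⟩
  have hu : ∀ t : ℝ, HasDerivAt
      (fun t : ℝ => ((bernoulliFun (K + 1) t : ℝ) : ℂ) / ((K + 1).factorial : ℂ))
      (((bernoulliFun K t : ℝ) : ℂ) / (K.factorial : ℂ)) t := by
    intro t
    have h1 := ((hasDerivAt_bernoulliFun (K + 1) t).ofReal_comp).div_const
      ((K + 1).factorial : ℂ)
    convert! h1 using 1
    have := Nat.factorial_pos K
    have hK : ((K : ℂ) + 1) ≠ 0 := Nat.cast_add_one_ne_zero K
    have hf : (K.factorial : ℂ) ≠ 0 := by exact_mod_cast this.ne'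
    rw [Nat.factorial_succ]
    push_cast
    field_simp
  have hv : ∀ t ∈ Set.uIcc (0 : ℝ) 1, HasDerivAt (fun t => h (a + t)) (h' (a + t)) t := by
    intro t ht
    exact HasDerivAt.comp_const_add a t (hd _ (hmem t ht))
  have hcont : ContinuousOn (fun t => h' (a + t)) (Set.uIcc (0 : ℝ) 1) :=
    hc.comp (by fun_prop) hmem
  have := intervalIntegral.integral_mul_deriv_eq_deriv_mul (fun t _ => hu t) hv
    (Continuous.intervalIntegrable (by fun_prop) 0 1) hcont.intervalIntegrable
  simpa [eulerMaclaurinRem] using this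

theorem eulerMaclaurinRem_zero {h h' : ℝ → ℂ} {a : ℝ}
    (hd : ∀ x ∈ Set.Icc a (a + 1), HasDerivAt h (h' x) x)
    (hc : ContinuousOn h' (Set.Icc a (a + 1))) :
    eulerMaclaurinRem 0 h' a = h (a + 1) - h a := by
  have hmem : ∀ t ∈ Set.uIcc (0 : ℝ) 1, a + t ∈ Set.Icc a (a + 1) := by
    intro t ht
    rw [Set.uIcc_of_le zero_le_one] at ht
    exact ⟨by linarith [ht.1], by linarith [ht.2]⟩
  have hv : ∀ t ∈ Set.uIcc (0 : ℝ) 1, HasDerivAt (fun t => h (a + t)) (h' (a + t)) t := by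
    intro t ht
    exact HasDerivAt.comp_const_add a t (hd _ (hmem t ht))
  have hcont : ContinuousOn (fun t => h' (a + t)) (Set.uIcc (0 : ℝ) 1) :=
    hc.comp (by fun_prop) hmem
  have := intervalIntegral.integral_eq_sub_of_hasDerivAt hv hcont.intervalIntegrable
  simpa [eulerMaclaurinRem] using this

/-- The Euler–Maclaurin formula on an interval of length one for `g 1`, where `g 0` is an
antiderivative of it and `g (k + 1)` is its `k`-th derivative. -/
theorem eulerMaclaurin_unit {g : ℕ → ℝ → ℂ} {a : ℝ}
    (hd : ∀ k, ∀ x ∈ Set.Icc a (a + 1), HasDerivAt (g k) (g (k + 1) x) x) (K : ℕ) :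
    (g 1 a + g 1 (a + 1)) / 2 + (-1) ^ (K + 1) * eulerMaclaurinRem (K + 1) (g (K + 2)) a
      = ∑ k ∈ Finset.range (K + 2), eulerMaclaurinCoeff k * (g k (a + 1) - g k a) := by
  have hc : ∀ k, ContinuousOn (g k) (Set.Icc a (a + 1)) := fun k x hx =>
    (hd k x hx).continuousAt.continuousWithinAt
  induction K with
  | zero =>
    have h1 := eulerMaclaurinRem_succ (K := 0) (hd 1) (hc 2)
    rw [eulerMaclaurinRem_zero (hd 0) (hc 1)] at h1
    simp only [zero_add, h1, bernoulliFun_eval_one, bernoulliFun_one, Nat.factorial_one,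
      Finset.sum_range_succ, Finset.sum_range_zero, eulerMaclaurinCoeff, bernoulliFun_zero,
      Nat.factorial_zero]
    push_cast
    simp
    ring
  | succ K ih =>
    have h1 := eulerMaclaurinRem_succ (K := K + 1) (hd (K + 2)) (hc (K + 3))
    rw [bernoulliFun_endpoints_eq_of_ne_one (by omega)] at h1
    rw [Finset.sum_range_succ, ← ih, h1, eulerMaclaurinCoeff, if_neg (by omega)]
    ring

/-- Summation of the Euler–Maclaurin formula with step `1 / n` over `[1, ∞)`: the boundary terms
telescope. -/
theorem tendsto_eulerMaclaurin {G : ℕ → ℝ → ℂ}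
    (hd : ∀ k, ∀ x : ℝ, 1 ≤ x → HasDerivAt (G k) (G (k + 1) x) x)
    (h0 : ∀ k, Tendsto (G k) atTop (𝓝 0)) (K : ℕ) {n : ℝ} (hn : 0 < n) :
    Tendsto (fun N : ℕ => ∑ l ∈ Finset.range N,
      ((G 1 ((n + l) / n) + G 1 ((n + l + 1) / n)) / 2 / n
        + (-1) ^ (K + 1) * eulerMaclaurinRem (K + 1) (fun x => G (K + 2) (x / n)) (n + l)
          / (n : ℂ) ^ (K + 2)))
      atTop (𝓝 (-∑ k ∈ Finset.range (K + 2), eulerMaclaurinCoeff k * (G k 1 / (n : ℂ) ^ k))) := by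
  have hn' : (n : ℂ) ≠ 0 := by exact_mod_cast hn.ne'
  let g : ℕ → ℝ → ℂ := fun k x => G k (x / n) / (n : ℂ) ^ k
  have hg : ∀ k, ∀ x : ℝ, n ≤ x → HasDerivAt (g k) (g (k + 1) x) x := by
    intro k x hx
    have h1 : 1 ≤ x / n := by rwa [le_div_iff₀ hn, one_mul]
    have h2 := ((hd k _ h1).scomp x ((hasDerivAt_id x).div_const n)).div_const ((n : ℂ) ^ k)
    convert! h2 using 1
    simp only [g, Complex.real_smul, pow_succ]
    push_cast
    field_simp
  have hunit : ∀ l : ℕ,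
      ((G 1 ((n + l) / n) + G 1 ((n + l + 1) / n)) / 2 / n
        + (-1) ^ (K + 1) * eulerMaclaurinRem (K + 1) (fun x => G (K + 2) (x / n)) (n + l)
          / (n : ℂ) ^ (K + 2))
      = ∑ k ∈ Finset.range (K + 2),
          eulerMaclaurinCoeff k * (g k (n + ((l + 1 : ℕ) : ℝ)) - g k (n + l)) := by
    intro l
    have h := eulerMaclaurin_unit (g := g) (a := n + l) (fun k x hx => hg k x (by
      have : (0 : ℝ) ≤ l := Nat.cast_nonneg l
      linarith [hx.1])) K
    have hr : eulerMaclaurinRem (K + 1) (g (K + 2)) (n + l)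
        = eulerMaclaurinRem (K + 1) (fun x => G (K + 2) (x / n)) (n + l) / (n : ℂ) ^ (K + 2) := by
      simp only [eulerMaclaurinRem, g]
      rw [← intervalIntegral.integral_div]
      simp only [mul_div_assoc]
    have hl : n + ((l + 1 : ℕ) : ℝ) = n + l + 1 := by push_cast; ring
    rw [hl, ← h, hr]
    simp only [g, pow_one]
    ring
  have hsum : ∀ N : ℕ, ∑ l ∈ Finset.range N, (∑ k ∈ Finset.range (K + 2),
        eulerMaclaurinCoeff k * (g k (n + ((l + 1 : ℕ) : ℝ)) - g k (n + l)))
      = ∑ k ∈ Finset.range (K + 2), eulerMaclaurinCoeff k * (g k (n + N) - g k n) := by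
    intro N
    rw [Finset.sum_comm]
    refine Finset.sum_congr rfl fun k _ => ?_
    rw [← Finset.mul_sum, Finset.sum_range_sub (fun l : ℕ => g k (n + l))]
    simp
  simp only [hunit, hsum]
  rw [← Finset.sum_neg_distrib]
  refine tendsto_finsetSum _ fun k _ => ?_
  rw [← mul_neg]
  refine Tendsto.const_mul _ ?_
  have h1 : Tendsto (fun N : ℕ => (n + (N : ℝ)) / n) atTop atTop :=
    (tendsto_atTop_add_const_left _ n tendsto_natCast_atTop_atTop).atTop_div_const hn
  have h2 := (((h0 k).comp h1).div_const ((n : ℂ) ^ k)).sub_const (g k n)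
  simp only [zero_div, zero_sub] at h2
  have h3 : g k n = G k 1 / (n : ℂ) ^ k := by simp only [g, div_self hn.ne']
  rw [h3] at h2
  exact h2.congr fun N => by simp [g, div_self hn.ne']

/-! ### Derivatives of powers of a polynomial, uniformly in the exponent -/

/-- The polynomials `Q_k` with
`(d/dx)^k (x ^ (e α) φ(1/x) ^ α) = x ^ (e α - k) φ(1/x) ^ (α - k) Q_k(1/x)`. -/
noncomputable def homPoly {R : Type*} [CommRing R] (φ : R[X]) (e α : R) : ℕ → R[X]
  | 0 => 1
  | k + 1 => C (e * α - k) * φ * homPoly φ e α k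
      - X * (φ * derivative (homPoly φ e α k) + C (α - k) * derivative φ * homPoly φ e α k)

theorem homPoly_map {R S : Type*} [CommRing R] [CommRing S] (f : R →+* S) (φ : R[X]) (e α : R)
    (k : ℕ) : (homPoly φ e α k).map f = homPoly (φ.map f) (f e) (f α) k := by
  induction k with
  | zero => simp [homPoly]
  | succ k ih => simp [homPoly, ← ih, derivative_map]

/-- A real polynomial in `y`, regarded as a polynomial in `y` over `ℂ[s]`. -/
noncomputable def biMap (φ : ℝ[X]) : ℂ[X][X] := φ.map (C.comp Complex.ofRealHom)

theorem biMap_map (φ : ℝ[X]) (s : ℂ) :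
    (biMap φ).map (evalRingHom s) = φ.map Complex.ofRealHom := by
  rw [biMap, Polynomial.map_map]
  congr 1
  ext x
  simp

/-- The functions `φ(y) ^ (-s - k) P(s, y)`, with `P` a polynomial in `s` and `y`. -/
noncomputable def symbol (φ : ℝ[X]) (P : ℂ[X][X]) (k : ℕ) (s : ℂ) (y : ℝ) : ℂ :=
  ((φ.eval y : ℝ) : ℂ) ^ (-s - k) * P.evalEval s (y : ℂ)

theorem evalEval_eq_sum (P : ℂ[X][X]) (s y : ℂ) :
    P.evalEval s y = ∑ i ∈ Finset.range (P.natDegree + 1), (P.coeff i).eval s * y ^ i := by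
  rw [evalEval, eval_eq_sum_range (p := P), eval_finsetSum]
  simp

section symbol

variable {φ : ℝ[X]} (P : ℂ[X][X]) (k : ℕ)

theorem continuousAt_symbol {s : ℂ} {y : ℝ} (hy : 0 < φ.eval y) :
    ContinuousAt (fun p : ℂ × ℝ => symbol φ P k p.1 p.2) (s, y) := by
  unfold symbol
  refine ContinuousAt.mul (ContinuousAt.cpow ?_ (by fun_prop) ?_) ?_
  · have := φ.continuous
    fun_prop
  · simpa [Complex.ofReal_mem_slitPlane] using hy
  · simp only [evalEval_eq_sum]
    refine Continuous.continuousAt (continuous_finsetSum _ fun i _ => ?_)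
    have := (P.coeff i).continuous
    fun_prop

theorem differentiable_symbol {y : ℝ} (hy : 0 < φ.eval y) :
    Differentiable ℂ fun s => symbol φ P k s y := by
  unfold symbol
  refine Differentiable.mul ?_ ?_
  · exact Differentiable.const_cpow (by fun_prop) (Or.inl (by exact_mod_cast hy.ne'))
  · simp only [evalEval_eq_sum]
    have := fun i => (P.coeff i).differentiable
    fun_prop

theorem exists_norm_symbol_le (hφ : ∀ y : ℝ, 0 ≤ y → 0 < φ.eval y) (z : ℂ) (R : ℝ) :
    ∃ C : ℝ, 0 ≤ C ∧ ∀ s ∈ Metric.closedBall z R, ∀ y ∈ Set.Icc (0 : ℝ) 1,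
      ‖symbol φ P k s y‖ ≤ C := by
  have hK : IsCompact (Metric.closedBall z R ×ˢ Set.Icc (0 : ℝ) 1) :=
    (isCompact_closedBall z R).prod isCompact_Icc
  obtain ⟨C, hC⟩ := hK.exists_bound_of_continuousOn
    (f := fun p : ℂ × ℝ => symbol φ P k p.1 p.2) fun p hp =>
      (continuousAt_symbol P k (hφ p.2 hp.2.1)).continuousWithinAt
  exact ⟨max C 0, le_max_right _ _, fun s hs y hy => (hC (s, y) ⟨hs, hy⟩).trans (le_max_left _ _)⟩

theorem continuousAt_symbol_right (s : ℂ) {y : ℝ} (hy : 0 < φ.eval y) :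
    ContinuousAt (fun y => symbol φ P k s y) y :=
  (continuousAt_symbol P k hy).comp (f := fun y : ℝ => (s, y)) (by fun_prop)

end symbol

theorem cpow_sub_one_mul {a : ℂ} (b : ℂ) (ha : a ≠ 0) : a ^ (b - 1) * a = a ^ b := by
  rw [Complex.cpow_sub _ _ ha, Complex.cpow_one, div_mul_cancel₀ _ ha]

theorem hasDerivAt_cpow_mul_eval (φ : ℝ[X]) (p : ℂ[X]) (b : ℂ) {y : ℝ} (hy : 0 < φ.eval y) :
    HasDerivAt (fun y : ℝ => ((φ.eval y : ℝ) : ℂ) ^ b * p.eval (y : ℂ))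
      (((φ.eval y : ℝ) : ℂ) ^ (b - 1) *
        (φ.map Complex.ofRealHom * derivative p
          + C b * derivative (φ.map Complex.ofRealHom) * p).eval (y : ℂ)) y := by
  have hev : ∀ (q : ℝ[X]) (x : ℝ), (q.map Complex.ofRealHom).eval (x : ℂ) = ((q.eval x : ℝ) : ℂ) :=
    fun q x => eval_map_apply Complex.ofRealHom x
  have h1 : HasDerivAt (fun y : ℝ => ((φ.eval y : ℝ) : ℂ) ^ b)
      (b * ((φ.eval y : ℝ) : ℂ) ^ (b - 1) * (((derivative φ).eval y : ℝ) : ℂ)) y := by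
    have := ((φ.map Complex.ofRealHom).hasDerivAt (y : ℂ)).cpow_const (c := b)
      (by rw [hev]; simpa [Complex.ofReal_mem_slitPlane] using hy)
    have h := this.comp_ofReal
    simpa only [hev, derivative_map] using h
  have h2 := h1.mul (p.hasDerivAt (y : ℂ)).comp_ofReal
  convert! h2 using 1
  have h3 : ((φ.eval y : ℝ) : ℂ) ^ b = ((φ.eval y : ℝ) : ℂ) ^ (b - 1) * ((φ.eval y : ℝ) : ℂ) := by
    have hne : ((φ.eval y : ℝ) : ℂ) ≠ 0 := by exact_mod_cast hy.ne'
    rw [cpow_sub_one_mul _ hne]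
  simp only [eval_add, eval_mul, eval_C, derivative_map, hev, h3]
  ring

/-- The `k`-th derivative in `y` of `φ(y) ^ (-s)`. -/
noncomputable def powDeriv (φ : ℝ[X]) (k : ℕ) (s : ℂ) (y : ℝ) : ℂ :=
  symbol φ (derivPoly (biMap φ) (-X) k) k s y

theorem powDeriv_eq (φ : ℝ[X]) (k : ℕ) (s : ℂ) (y : ℝ) :
    powDeriv φ k s y = ((φ.eval y : ℝ) : ℂ) ^ (-s - k)
      * (derivPoly (φ.map Complex.ofRealHom) (-s) k).eval (y : ℂ) := by
  rw [powDeriv, symbol, ← map_evalRingHom_eval, derivPoly_map, biMap_map]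
  simp

theorem hasDerivAt_powDeriv (φ : ℝ[X]) (k : ℕ) (s : ℂ) {y : ℝ} (hy : 0 < φ.eval y) :
    HasDerivAt (powDeriv φ k s) (powDeriv φ (k + 1) s y) y := by
  have h := hasDerivAt_cpow_mul_eval φ (derivPoly (φ.map Complex.ofRealHom) (-s) k) (-s - k) hy
  have he : powDeriv φ k s = fun y : ℝ => ((φ.eval y : ℝ) : ℂ) ^ (-s - k)
      * (derivPoly (φ.map Complex.ofRealHom) (-s) k).eval (y : ℂ) := funext (powDeriv_eq φ k s)
  rw [he, powDeriv_eq]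
  convert! h using 3
  push_cast
  ring

/-- The `k`-th derivative in `x` of `x ^ (-e s) φ(1/x) ^ (-s)`. -/
noncomputable def homDeriv (e : ℕ) (φ : ℝ[X]) (k : ℕ) (s : ℂ) (x : ℝ) : ℂ :=
  (x : ℂ) ^ (-(e * s) - k) * symbol φ (homPoly (biMap φ) (e : ℂ[X]) (-X) k) k s x⁻¹

theorem homDeriv_eq (e : ℕ) (φ : ℝ[X]) (k : ℕ) (s : ℂ) (x : ℝ) :
    homDeriv e φ k s x = (x : ℂ) ^ (-(e * s) - k) * (((φ.eval x⁻¹ : ℝ) : ℂ) ^ (-s - k)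
      * (homPoly (φ.map Complex.ofRealHom) (e : ℂ) (-s) k).eval ((x⁻¹ : ℝ) : ℂ)) := by
  rw [homDeriv, symbol, ← map_evalRingHom_eval, homPoly_map, biMap_map]
  simp

theorem homDeriv_zero (e : ℕ) (φ : ℝ[X]) (s : ℂ) (x : ℝ) :
    homDeriv e φ 0 s x = (x : ℂ) ^ (-(e * s)) * ((φ.eval x⁻¹ : ℝ) : ℂ) ^ (-s) := by
  simp [homDeriv_eq, homPoly]

theorem hasDerivAt_homDeriv (e : ℕ) {φ : ℝ[X]} (hφ : ∀ y : ℝ, 0 ≤ y → 0 < φ.eval y) (k : ℕ) (s : ℂ)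
    {x : ℝ} (hx : 0 < x) :
    HasDerivAt (homDeriv e φ k s) (homDeriv e φ (k + 1) s x) x := by
  set q := homPoly (φ.map Complex.ofRealHom) (e : ℂ) (-s) k with hq
  have h1 := hasDerivAt_cpow_mul_eval φ q (-s - k) (hφ x⁻¹ (inv_nonneg.mpr hx.le))
  have h2 := h1.scomp x (hasDerivAt_inv hx.ne')
  have hx' : (x : ℂ) ≠ 0 := by exact_mod_cast hx.ne'
  have h3 : HasDerivAt (fun x : ℝ => (x : ℂ) ^ (-(e * s) - k))
      ((-(e * s) - k) * (x : ℂ) ^ (-(e * s) - k - 1)) x := by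
    have := ((hasDerivAt_id (x : ℂ)).cpow_const (c := -(e * s) - k)
      (by simpa [Complex.ofReal_mem_slitPlane] using hx)).comp_ofReal
    simpa using this
  have h4 := h3.mul h2
  have he : homDeriv e φ k s = fun x : ℝ => (x : ℂ) ^ (-(e * s) - k)
      * (((φ.eval x⁻¹ : ℝ) : ℂ) ^ (-s - k) * q.eval ((x⁻¹ : ℝ) : ℂ)) :=
    funext (homDeriv_eq e φ k s)
  rw [he, homDeriv_eq]
  convert! h4 using 1
  have h5 : ((φ.eval x⁻¹ : ℝ) : ℂ) ≠ 0 := by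
    exact_mod_cast (hφ x⁻¹ (inv_nonneg.mpr hx.le)).ne'
  have h6 : ((φ.eval x⁻¹ : ℝ) : ℂ) ^ (-s - k)
      = ((φ.eval x⁻¹ : ℝ) : ℂ) ^ (-s - k - 1) * ((φ.eval x⁻¹ : ℝ) : ℂ) := by
    rw [cpow_sub_one_mul _ h5]
  have h7 : (x : ℂ) ^ (-(e * s) - k) = (x : ℂ) ^ (-(e * s) - k - 1) * x := by
    rw [cpow_sub_one_mul _ hx']
  have h8 : -(e * s) - ((k + 1 : ℕ) : ℂ) = -(e * s) - k - 1 := by push_cast; ring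
  have h9 : -s - ((k + 1 : ℕ) : ℂ) = -s - k - 1 := by push_cast; ring
  have hev : (φ.map Complex.ofRealHom).eval ((x⁻¹ : ℝ) : ℂ) = ((φ.eval x⁻¹ : ℝ) : ℂ) :=
    eval_map_apply Complex.ofRealHom x⁻¹
  simp only [homPoly, ← hq, h8, h9, Function.comp, Complex.real_smul, h6, h7, eval_sub, eval_mul,
    eval_add, eval_C, eval_X, hev]
  push_cast
  field_simp
  ring

/-! ### Continuation of the integral over a ray -/

/-- The integral `∫_0^1 y ^ (e s - 2 + k) (d/dy)^k φ(y) ^ (-s) dy`. For `k = 0` it is the integral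
of `x ^ (-e s) φ(1/x) ^ (-s)` over `x ≥ 1`. -/
noncomputable def rayIntegral (e : ℕ) (φ : ℝ[X]) (k : ℕ) (s : ℂ) : ℂ :=
  ∫ y in (0 : ℝ)..1, (y : ℂ) ^ (e * s - 2 + k) * powDeriv φ k s y

section rayIntegral

variable {e : ℕ} {φ : ℝ[X]} (hφ : ∀ y : ℝ, 0 ≤ y → 0 < φ.eval y)
include hφ

theorem continuousOn_powDeriv (k : ℕ) (s : ℂ) : ContinuousOn (powDeriv φ k s) (Set.Ici 0) :=
  fun y hy => (continuousAt_symbol_right _ k s (hφ y hy)).continuousWithinAt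

theorem intervalIntegrable_rayIntegrand (k : ℕ) {s : ℂ} (hs : 0 < (e * s - 1 + k : ℂ).re) {a : ℝ}
    (ha : 0 ≤ a) : IntervalIntegrable (fun y : ℝ => (y : ℂ) ^ (e * s - 2 + k) * powDeriv φ k s y)
      MeasureTheory.volume 0 a := by
  refine (intervalIntegral.intervalIntegrable_cpow' ?_).mul_continuousOn ?_
  · simp only [Complex.add_re, Complex.sub_re, Complex.one_re, Complex.re_ofNat] at hs ⊢
    linarith
  · refine (continuousOn_powDeriv hφ k s).mono ?_
    rw [Set.uIcc_of_le ha]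
    exact Set.Icc_subset_Ici_self

theorem differentiableAt_rayIntegral (k : ℕ) {z : ℂ} (hz : 0 < (e * z - 1 + k : ℂ).re) :
    DifferentiableAt ℂ (rayIntegral e φ k) z := by
  set δ : ℝ := (e * z - 1 + k : ℂ).re / 2 with hδ
  have hδ0 : 0 < δ := by positivity
  set R : ℝ := δ / (e + 1) with hR
  have hR0 : 0 < R := by positivity
  obtain ⟨C, hC0, hC⟩ := exists_norm_symbol_le (φ := φ) (derivPoly (biMap φ) (-X) k) k hφ z R
  have hre : ∀ s ∈ Metric.ball z R, δ - 1 ≤ (e * s - 2 + k : ℂ).re := by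
    intro s hs
    have h1 : |(s - z).re| ≤ R := (Complex.abs_re_le_norm _).trans (by
      rw [← dist_eq_norm]; exact (Metric.mem_ball.mp hs).le)
    have h2 : z.re - R ≤ s.re := by
      have := (abs_le.mp h1).1
      simp only [Complex.sub_re] at this
      linarith
    have h3 : (e : ℝ) * R ≤ δ := by
      rw [hR, mul_div_assoc', div_le_iff₀ (by positivity)]
      nlinarith
    have h4 : (e : ℝ) * (z.re - R) ≤ e * s.re := mul_le_mul_of_nonneg_left h2 (Nat.cast_nonneg e)
    simp [Complex.mul_re] at hδ hz ⊢
    nlinarith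
  have hmem : ∀ᵐ y : ℝ ∂(MeasureTheory.volume.restrict (Set.Ioc (0 : ℝ) 1)),
      y ∈ Set.Ioc (0 : ℝ) 1 :=
    MeasureTheory.ae_restrict_mem measurableSet_Ioc
  have h := differentiableAt_integral_of_bound
    (μ := MeasureTheory.volume.restrict (Set.Ioc (0 : ℝ) 1))
    (F := fun s y => (y : ℂ) ^ (e * s - 2 + k) * powDeriv φ k s y) (z := z)
    (bound := fun y => y ^ (δ - 1) * C) hR0 ?_ ?_ ?_ ?_
  · refine h.congr_of_eventuallyEq (Eventually.of_forall fun s => ?_)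
    simp only [rayIntegral]
    rw [intervalIntegral.integral_of_le zero_le_one]
  · intro s _
    refine ContinuousOn.aestronglyMeasurable (fun y hy => ?_) measurableSet_Ioc
    refine ContinuousAt.continuousWithinAt (ContinuousAt.mul ?_
      (continuousAt_symbol_right _ k s (hφ y hy.1.le)))
    exact Complex.continuousAt_ofReal_cpow_const _ _ (Or.inr hy.1.ne')
  · filter_upwards [hmem] with y hy
    refine Differentiable.differentiableOn (Differentiable.mul ?_
      (differentiable_symbol _ k (hφ y hy.1.le)))
    exact Differentiable.const_cpow (by fun_prop) (Or.inl (by exact_mod_cast hy.1.ne'))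
  · filter_upwards [hmem] with y hy s hs
    rw [norm_mul, Complex.norm_cpow_eq_rpow_re_of_pos hy.1]
    refine mul_le_mul (Real.rpow_le_rpow_of_exponent_ge hy.1 hy.2 (hre s hs))
      (hC s (Metric.ball_subset_closedBall hs) y ⟨hy.1.le, hy.2⟩) (norm_nonneg _)
      (Real.rpow_nonneg hy.1.le _)
  · have := (intervalIntegral.intervalIntegrable_rpow' (a := 0) (b := 1) (r := δ - 1)
      (by linarith)).mul_const C
    rwa [intervalIntegrable_iff_integrableOn_Ioc_of_le zero_le_one] at this

theorem analyticAt_rayIntegral (k : ℕ) {z : ℂ} (hz : 0 < (e * z - 1 + k : ℂ).re) :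
    AnalyticAt ℂ (rayIntegral e φ k) z := by
  have hopen : IsOpen {s : ℂ | 0 < (e * s - 1 + k : ℂ).re} :=
    isOpen_lt continuous_const (by fun_prop)
  exact DifferentiableOn.analyticAt (s := {s : ℂ | 0 < (e * s - 1 + k : ℂ).re})
    (fun w hw => (differentiableAt_rayIntegral hφ k hw).differentiableWithinAt) (hopen.mem_nhds hz)

/-- Integration by parts. -/
theorem rayIntegral_eq (k : ℕ) {s : ℂ} (hs : 0 < (e * s - 1 + k : ℂ).re) :
    rayIntegral e φ k s = (powDeriv φ k s 1 - rayIntegral e φ (k + 1) s) / (e * s - 1 + k) := by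
  have hw : (e * s - 1 + k : ℂ) ≠ 0 := by
    intro h
    rw [h] at hs
    simp at hs
  have hI : Set.uIcc (0 : ℝ) 1 = Set.Icc 0 1 := Set.uIcc_of_le zero_le_one
  have hu : ∀ k, ContinuousOn (powDeriv φ k s) (Set.uIcc 0 1) := fun k =>
    (continuousOn_powDeriv hφ k s).mono (by rw [hI]; exact Set.Icc_subset_Ici_self)
  have hv : ContinuousOn (fun y : ℝ => (y : ℂ) ^ (e * s - 1 + k) / (e * s - 1 + k))
      (Set.uIcc 0 1) := by
    refine ContinuousOn.div_const (fun y _ => ?_) _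
    exact (Complex.continuousAt_ofReal_cpow_const _ _ (Or.inl hs)).continuousWithinAt
  have hparts := intervalIntegral.integral_mul_deriv_eq_deriv_mul_of_hasDerivAt (a := 0) (b := 1)
    (u := powDeriv φ k s) (u' := powDeriv φ (k + 1) s)
    (v := fun y : ℝ => (y : ℂ) ^ (e * s - 1 + k) / (e * s - 1 + k))
    (v' := fun y : ℝ => (y : ℂ) ^ (e * s - 2 + k)) (hu k) hv
    (fun y hy => hasDerivAt_powDeriv φ k s (hφ y (by
      rw [min_eq_left zero_le_one] at hy; exact hy.1.le)))
    (fun y hy => ?_) (hu (k + 1)).intervalIntegrable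
    (intervalIntegral.intervalIntegrable_cpow' (by
      simp only [Complex.add_re, Complex.sub_re, Complex.one_re, Complex.re_ofNat] at hs ⊢
      linarith))
  · have h1 : rayIntegral e φ k s
        = ∫ y in (0 : ℝ)..1, powDeriv φ k s y * (y : ℂ) ^ (e * s - 2 + k) := by
      simp only [rayIntegral, mul_comm]
    have h2 : rayIntegral e φ (k + 1) s / (e * s - 1 + k) = ∫ y in (0 : ℝ)..1,
        powDeriv φ (k + 1) s y * ((y : ℂ) ^ (e * s - 1 + k) / (e * s - 1 + k)) := by
      rw [rayIntegral, ← intervalIntegral.integral_div]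
      refine intervalIntegral.integral_congr fun y _ => ?_
      have : (e * s - 2 + ((k + 1 : ℕ) : ℂ)) = e * s - 1 + k := by push_cast; ring
      simp only [this]
      ring
    rw [h1, hparts, sub_div, h2, Complex.ofReal_one, Complex.one_cpow, Complex.ofReal_zero,
      Complex.zero_cpow hw]
    ring
  · rw [min_eq_left zero_le_one] at hy
    have hy0 : (0 : ℝ) < y := hy.1
    have h := ((hasDerivAt_id (y : ℂ)).cpow_const (c := e * s - 1 + k)
      (by simpa [Complex.ofReal_mem_slitPlane] using hy0)).comp_ofReal.div_const (e * s - 1 + k)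
    convert! h using 1
    have : (e * s - 1 + k - 1 : ℂ) = e * s - 2 + k := by ring
    simp only [id, this]
    field_simp

end rayIntegral

/-- The continuation of `rayIntegral e φ k` to `Re (e s - 1 + k + L) > 0` that `L` integrations by
parts give. -/
noncomputable def rayContinuation (e : ℕ) (φ : ℝ[X]) : ℕ → ℕ → ℂ → ℂ
  | 0, k, s => rayIntegral e φ k s
  | L + 1, k, s => (powDeriv φ k s 1 - rayContinuation e φ L (k + 1) s) / (e * s - 1 + k)

section rayContinuation

variable {e : ℕ} {φ : ℝ[X]} (hφ : ∀ y : ℝ, 0 ≤ y → 0 < φ.eval y)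
include hφ

theorem analyticAt_powDeriv_left (k : ℕ) {y : ℝ} (hy : 0 ≤ y) (z : ℂ) :
    AnalyticAt ℂ (fun s => powDeriv φ k s y) z :=
  (differentiable_symbol _ k (hφ y hy)).analyticAt z

theorem rayContinuation_eq (L k : ℕ) {s : ℂ} (hs : 0 < (e * s - 1 + k : ℂ).re) :
    rayContinuation e φ L k s = rayIntegral e φ k s := by
  induction L generalizing k with
  | zero => rfl
  | succ L ih =>
    rw [rayContinuation, ih, ← rayIntegral_eq hφ k hs]
    simp only [Complex.add_re, Complex.natCast_re] at hs ⊢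
    push_cast
    linarith

theorem meromorphicAt_rayContinuation (L k : ℕ) {z : ℂ} (hz : 0 < (e * z - 1 + k + L : ℂ).re) :
    MeromorphicAt (rayContinuation e φ L k) z := by
  induction L generalizing k with
  | zero => exact (analyticAt_rayIntegral hφ k (by simpa using hz)).meromorphicAt
  | succ L ih =>
    have h1 := ih (k + 1) (by
      simp only [Complex.add_re, Complex.natCast_re] at hz ⊢
      push_cast at hz ⊢
      linarith)
    have h2 := (analyticAt_powDeriv_left hφ k zero_le_one z).meromorphicAt
    have h3 : MeromorphicAt (fun s : ℂ => e * s - 1 + k) z := by fun_prop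
    exact (h2.sub h1).div h3

/-- The fundamental theorem of calculus collapses the numerator after the last integration by parts
to the derivative at `0`, hence the residue is a Taylor coefficient. -/
theorem hasSimplePoleAt_rayContinuation (he : e ≠ 0) (L k : ℕ) {z : ℂ}
    (hz : (e * z - 1 + k + L : ℂ) = 0) :
    HasSimplePoleAt (rayContinuation e φ (L + 1) k) z
      (1 / e * (powDeriv φ (k + L) z 0 / L.factorial)) := by
  have he' : (e : ℂ) ≠ 0 := by exact_mod_cast he
  induction L generalizing k with
  | zero =>
    simp only [Nat.cast_zero, add_zero] at hz
    have hz1 : 0 < (e * z - 1 + (k + 1 : ℕ) : ℂ).re := by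
      have : (e * z - 1 + (k + 1 : ℕ) : ℂ) = 1 := by push_cast; linear_combination hz
      rw [this]; simp
    refine ⟨fun s => (powDeriv φ k s 1 - rayIntegral e φ (k + 1) s) / e,
      ((analyticAt_powDeriv_left hφ k zero_le_one z).sub
        (analyticAt_rayIntegral hφ (k + 1) hz1)).div_const, ?_, ?_⟩
    · have h1 : rayIntegral e φ (k + 1) z = powDeriv φ k z 1 - powDeriv φ k z 0 := by
        have hexp : (e * z - 2 + (k + 1 : ℕ) : ℂ) = 0 := by push_cast; linear_combination hz
        simp only [rayIntegral, hexp, Complex.cpow_zero, one_mul]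
        have hI : Set.uIcc (0 : ℝ) 1 = Set.Icc 0 1 := Set.uIcc_of_le zero_le_one
        refine intervalIntegral.integral_eq_sub_of_hasDerivAt (fun y hy => ?_) ?_
        · rw [hI] at hy
          exact hasDerivAt_powDeriv φ k z (hφ y hy.1)
        · refine ContinuousOn.intervalIntegrable ((continuousOn_powDeriv hφ (k + 1) z).mono ?_)
          rw [hI]
          exact Set.Icc_subset_Ici_self
      simp only [h1, add_zero, Nat.factorial_zero, Nat.cast_one, div_one]
      ring
    · filter_upwards [self_mem_nhdsWithin] with s hs
      have h1 : (e * s - 1 + k : ℂ) = e * (s - z) := by linear_combination hz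
      rw [rayContinuation, rayContinuation, h1, div_div]
  | succ L ih =>
    have h1 := ih (k + 1) (by push_cast at hz ⊢; linear_combination hz)
    have h2 := HasSimplePoleAt.of_analyticAt (analyticAt_powDeriv_left hφ k zero_le_one z)
    have hzL : (e * z - 1 + k : ℂ) = -(L + 1) := by push_cast at hz; linear_combination hz
    have hL : (L + 1 : ℂ) ≠ 0 := Nat.cast_add_one_ne_zero L
    have hden : AnalyticAt ℂ (fun s : ℂ => 1 / (e * s - 1 + k)) z := by
      refine AnalyticAt.div (by fun_prop) (by fun_prop) ?_
      rw [hzL]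
      exact neg_ne_zero.mpr hL
    have h3 := (h2.add (h1.mul_analyticAt (a := fun _ => -1) analyticAt_const)).mul_analyticAt hden
    have hval : (1 / (e * z - 1 + k : ℂ)) * (0 + -1 * (1 / e *
        (powDeriv φ (k + 1 + L) z 0 / L.factorial)))
        = 1 / e * (powDeriv φ (k + (L + 1)) z 0 / (L + 1).factorial) := by
      have hf : (L.factorial : ℂ) ≠ 0 := by exact_mod_cast L.factorial_ne_zero
      rw [hzL, Nat.factorial_succ, show k + 1 + L = k + (L + 1) by ring]
      push_cast
      field_simp
      ring
    rw [hval] at h3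
    refine h3.congr (Eventually.of_forall fun s => ?_)
    rw [rayContinuation]
    ring

end rayContinuation

/-! ### The remainder of the Euler–Maclaurin expansion -/

theorem norm_homDeriv {e : ℕ} {φ : ℝ[X]} {k : ℕ} {s : ℂ} {x : ℝ} (hx : 0 < x) :
    ‖homDeriv e φ k s x‖ = x ^ (-(e * s.re) - k)
      * ‖symbol φ (homPoly (biMap φ) (e : ℂ[X]) (-X) k) k s x⁻¹‖ := by
  rw [homDeriv, norm_mul, Complex.norm_cpow_eq_rpow_re_of_pos hx]
  simp [Complex.mul_re]

/-- The Euler–Maclaurin remainder of order `K + 1` of the sum over `m ≥ n` of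
`n ^ (-s) m ^ (-e s) φ(n/m) ^ (-s)`, on `m ∈ [n + l, n + l + 1]`; here the pair `p` is
`(n - 1, l)`. -/
noncomputable def remTerm (e : ℕ) (φ : ℝ[X]) (K : ℕ) (s : ℂ) (p : ℕ × ℕ) : ℂ :=
  ((p.1 + 1 : ℕ) : ℂ) ^ (1 - (e + 1) * s) / ((p.1 + 1 : ℕ) : ℂ) ^ (K + 2)
    * eulerMaclaurinRem (K + 1) (fun x => homDeriv e φ (K + 1) s (x / (p.1 + 1 : ℕ)))
      ((p.1 + 1 : ℕ) + p.2)

theorem summable_one_div_sq_mul :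
    Summable fun p : ℕ × ℕ => 1 / ((p.1 : ℝ) + 1) ^ 2 * (1 / ((p.2 : ℝ) + 1) ^ 2) := by
  have h : Summable fun n : ℕ => 1 / ((n : ℝ) + 1) ^ 2 := by
    have := (summable_nat_add_iff 1).mpr (Real.summable_one_div_nat_pow (p := 2).mpr one_lt_two)
    simpa using this
  exact h.mul_of_nonneg h (fun n => by positivity) (fun n => by positivity)

section remainder

variable {e : ℕ} {φ : ℝ[X]} (hφ : ∀ y : ℝ, 0 ≤ y → 0 < φ.eval y) (M : ℕ)
include hφ

/-- The order of the derivative makes up for the growth of `x ^ (-e s)` on the disc of radius `M`: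
the exponent `-e Re s - ((e + 1) M + 4)` is at most `-4` there. The extra `M` in the order is used
in the summation over `n`. -/
theorem exists_norm_homDeriv_le :
    ∃ C : ℝ, 0 ≤ C ∧ ∀ s ∈ Metric.ball (0 : ℂ) M, ∀ x : ℝ, 1 ≤ x →
      ‖homDeriv e φ ((e + 1) * M + 3 + 1) s x‖ ≤ C / x ^ 4 := by
  obtain ⟨C, hC0, hC⟩ := exists_norm_symbol_le (φ := φ)
    (homPoly (biMap φ) (e : ℂ[X]) (-X) ((e + 1) * M + 3 + 1)) ((e + 1) * M + 3 + 1) hφ 0 M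
  refine ⟨C, hC0, fun s hs x hx => ?_⟩
  have hx0 : 0 < x := by linarith
  have hre : |s.re| ≤ M := (Complex.abs_re_le_norm s).trans (mem_ball_zero_iff.mp hs).le
  rw [norm_homDeriv hx0]
  have h1 : x ^ (-(e * s.re) - (((e + 1) * M + 3 + 1 : ℕ) : ℝ)) ≤ x ^ (-(4 : ℝ)) := by
    refine Real.rpow_le_rpow_of_exponent_le hx ?_
    have h2 : (e : ℝ) * (-s.re) ≤ e * M :=
      mul_le_mul_of_nonneg_left (by linarith [(abs_le.mp hre).1]) (Nat.cast_nonneg e)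
    have h3 : (0 : ℝ) ≤ M := Nat.cast_nonneg M
    push_cast
    nlinarith
  have h2 := hC s (Metric.ball_subset_closedBall hs) x⁻¹
    ⟨inv_nonneg.mpr hx0.le, inv_le_one_of_one_le₀ hx⟩
  calc _ ≤ x ^ (-(4 : ℝ)) * C :=
        mul_le_mul h1 h2 (norm_nonneg _) (Real.rpow_nonneg hx0.le _)
    _ = C / x ^ 4 := by
        rw [Real.rpow_neg hx0.le, div_eq_inv_mul]
        norm_cast

theorem exists_norm_remTerm_le :
    ∃ C : ℝ, ∀ s ∈ Metric.ball (0 : ℂ) M, ∀ p : ℕ × ℕ,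
      ‖remTerm e φ ((e + 1) * M + 3) s p‖
        ≤ C * (1 / ((p.1 : ℝ) + 1) ^ 2 * (1 / ((p.2 : ℝ) + 1) ^ 2)) := by
  obtain ⟨C, hC0, hC⟩ := exists_norm_homDeriv_le (e := e) hφ M
  set K := (e + 1) * M + 3 with hK
  obtain ⟨B, hB⟩ := isCompact_Icc.exists_bound_of_continuousOn
    (f := fun t : ℝ => ((bernoulliFun (K + 1) t : ℝ) : ℂ) / ((K + 1).factorial : ℂ))
    (s := Set.Icc (0 : ℝ) 1) (Continuous.continuousOn (by fun_prop))
  have hB0 : 0 ≤ B := (norm_nonneg _).trans (hB 0 ⟨le_rfl, zero_le_one⟩)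
  refine ⟨B * C, fun s hs p => ?_⟩
  have hre : |s.re| ≤ M := (Complex.abs_re_le_norm s).trans (mem_ball_zero_iff.mp hs).le
  set ν : ℝ := (p.1 : ℝ) + 1 with hν
  have hν1 : 1 ≤ ν := by rw [hν]; linarith [(Nat.cast_nonneg p.1 : (0 : ℝ) ≤ p.1)]
  have hν0 : 0 < ν := by linarith
  have hl0 : (0 : ℝ) ≤ p.2 := Nat.cast_nonneg _
  have hcast : ((p.1 + 1 : ℕ) : ℝ) = ν := by rw [hν]; push_cast; ring
  have hcastC : ((p.1 + 1 : ℕ) : ℂ) = ((ν : ℝ) : ℂ) := by rw [← hcast]; norm_cast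
  have h1 : ‖eulerMaclaurinRem (K + 1) (fun x => homDeriv e φ (K + 1) s (x / (p.1 + 1 : ℕ)))
      ((p.1 + 1 : ℕ) + p.2)‖ ≤ B * (C / ((ν + p.2) / ν) ^ 4) := by
    rw [eulerMaclaurinRem, hcast]
    refine (intervalIntegral.norm_integral_le_of_norm_le_const
      (C := B * (C / ((ν + p.2) / ν) ^ 4)) fun t ht => ?_).trans (by simp)
    rw [Set.uIoc_of_le zero_le_one] at ht
    rw [norm_mul]
    refine mul_le_mul (hB t ⟨ht.1.le, ht.2⟩) ?_ (norm_nonneg _) hB0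
    have h2 : (ν + p.2) / ν ≤ (ν + p.2 + t) / ν :=
      div_le_div_of_nonneg_right (by linarith [ht.1]) hν0.le
    have h3 : 1 ≤ (ν + p.2) / ν := by
      rw [le_div_iff₀ hν0]; linarith
    refine (hC s hs _ (h3.trans h2)).trans ?_
    gcongr
  have h4 : ‖((p.1 + 1 : ℕ) : ℂ) ^ (1 - (e + 1) * s) / ((p.1 + 1 : ℕ) : ℂ) ^ (K + 2)‖
      ≤ 1 / ν ^ 4 := by
    rw [norm_div, norm_pow, hcastC, Complex.norm_cpow_eq_rpow_re_of_pos hν0, Complex.norm_real,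
      Real.norm_of_nonneg hν0.le, div_le_div_iff₀ (by positivity) (by positivity), one_mul,
      ← Real.rpow_natCast ν 4, ← Real.rpow_natCast ν (K + 2), ← Real.rpow_add hν0]
    refine Real.rpow_le_rpow_of_exponent_le hν1 ?_
    have h2 : ((e : ℝ) + 1) * (-s.re) ≤ (e + 1) * M :=
      mul_le_mul_of_nonneg_left (by linarith [(abs_le.mp hre).1]) (by positivity)
    have h3 : (1 - ((e : ℂ) + 1) * s).re = 1 - (e + 1) * s.re := by
      simp [Complex.mul_re]
    rw [h3, hK]
    push_cast
    linarith
  rw [remTerm, norm_mul]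
  calc _ ≤ 1 / ν ^ 4 * (B * (C / ((ν + p.2) / ν) ^ 4)) :=
        mul_le_mul h4 h1 (norm_nonneg _) (by positivity)
    _ = B * C * (1 / (ν + p.2) ^ 4) := by
        field_simp
    _ ≤ B * C * (1 / ν ^ 2 * (1 / ((p.2 : ℝ) + 1) ^ 2)) := by
        refine mul_le_mul_of_nonneg_left ?_ (by positivity)
        rw [one_div_mul_one_div]
        refine one_div_le_one_div_of_le (by positivity) ?_
        have h5 : ν ^ 2 ≤ (ν + p.2) ^ 2 := pow_le_pow_left₀ hν0.le (by linarith) 2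
        have h6 : ((p.2 : ℝ) + 1) ^ 2 ≤ (ν + p.2) ^ 2 :=
          pow_le_pow_left₀ (by positivity) (by linarith) 2
        calc ν ^ 2 * ((p.2 : ℝ) + 1) ^ 2 ≤ (ν + p.2) ^ 2 * (ν + p.2) ^ 2 := by gcongr
          _ = (ν + p.2) ^ 4 := by ring

theorem summable_remTerm {s : ℂ} (hs : s ∈ Metric.ball (0 : ℂ) M) :
    Summable (remTerm e φ ((e + 1) * M + 3) s) := by
  obtain ⟨C, hC⟩ := exists_norm_remTerm_le (e := e) hφ M
  exact Summable.of_norm_bounded (summable_one_div_sq_mul.mul_left C) (hC s hs)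

theorem differentiableOn_remTerm (p : ℕ × ℕ) :
    DifferentiableOn ℂ (fun s => remTerm e φ ((e + 1) * M + 3) s p) (Metric.ball 0 M) := by
  obtain ⟨C, hC0, hC⟩ := exists_norm_homDeriv_le (e := e) hφ M
  set K := (e + 1) * M + 3 with hK
  obtain ⟨B, hB⟩ := isCompact_Icc.exists_bound_of_continuousOn
    (f := fun t : ℝ => ((bernoulliFun (K + 1) t : ℝ) : ℂ) / ((K + 1).factorial : ℂ))
    (s := Set.Icc (0 : ℝ) 1) (Continuous.continuousOn (by fun_prop))
  have hB0 : 0 ≤ B := (norm_nonneg _).trans (hB 0 ⟨le_rfl, zero_le_one⟩)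
  set ν : ℝ := ((p.1 + 1 : ℕ) : ℝ) with hν
  have hν0 : 0 < ν := by rw [hν]; exact_mod_cast Nat.succ_pos _
  have hl0 : (0 : ℝ) ≤ p.2 := Nat.cast_nonneg _
  have hνC : ((p.1 + 1 : ℕ) : ℂ) ≠ 0 := Nat.cast_ne_zero.mpr (Nat.succ_ne_zero _)
  have hx : ∀ t ∈ Set.Ioc (0 : ℝ) 1, 1 ≤ (ν + p.2 + t) / ν := fun t ht => by
    rw [le_div_iff₀ hν0]; linarith [ht.1]
  have hmem : ∀ᵐ t : ℝ ∂(MeasureTheory.volume.restrict (Set.Ioc (0 : ℝ) 1)),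
      t ∈ Set.Ioc (0 : ℝ) 1 :=
    MeasureTheory.ae_restrict_mem measurableSet_Ioc
  intro z hz
  refine DifferentiableAt.differentiableWithinAt ?_
  unfold remTerm
  refine DifferentiableAt.mul ?_ ?_
  · refine DifferentiableAt.div_const ?_ _
    exact DifferentiableAt.const_cpow (by fun_prop) (Or.inl hνC)
  · simp only [eulerMaclaurinRem, intervalIntegral.integral_of_le (zero_le_one (α := ℝ))]
    obtain ⟨R, hR0, hR⟩ := Metric.isOpen_iff.mp Metric.isOpen_ball z hz
    refine differentiableAt_integral_of_bound hR0 (bound := fun _ => B * C) ?_ ?_ ?_ ?_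
    · intro s _
      refine ContinuousOn.aestronglyMeasurable (fun t ht => ?_) measurableSet_Ioc
      refine ContinuousAt.continuousWithinAt (ContinuousAt.mul
        (Continuous.continuousAt (by fun_prop)) ?_)
      have h1 := (hasDerivAt_homDeriv e hφ (K + 1) s
        (by linarith [hx t ht] : 0 < (ν + p.2 + t) / ν)).continuousAt
      exact ContinuousAt.comp' (f := fun t : ℝ => (ν + p.2 + t) / ν) h1 (by fun_prop)
    · filter_upwards [hmem] with t ht
      have h0 : 0 < (ν + p.2 + t) / ν := by linarith [hx t ht]
      refine Differentiable.differentiableOn (Differentiable.const_mul ?_ _)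
      unfold homDeriv
      refine Differentiable.mul ?_ (differentiable_symbol _ _ (hφ _ (inv_nonneg.mpr h0.le)))
      exact Differentiable.const_cpow (by fun_prop) (Or.inl (Complex.ofReal_ne_zero.mpr h0.ne'))
    · filter_upwards [hmem] with t ht s hs
      rw [norm_mul]
      refine mul_le_mul (hB t ⟨ht.1.le, ht.2⟩) ?_ (norm_nonneg _) hB0
      refine (hC s (hR hs) _ (hx t ht)).trans (div_le_self hC0 ?_)
      exact one_le_pow₀ (hx t ht)
    · exact MeasureTheory.integrable_const _

theorem analyticAt_tsum_remTerm {z : ℂ} (hz : z ∈ Metric.ball (0 : ℂ) M) :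
    AnalyticAt ℂ (fun s => ∑' p, remTerm e φ ((e + 1) * M + 3) s p) z := by
  obtain ⟨C, hC⟩ := exists_norm_remTerm_le (e := e) hφ M
  exact (Complex.differentiableOn_tsum_of_summable_norm (summable_one_div_sq_mul.mul_left C)
    (differentiableOn_remTerm hφ M) Metric.isOpen_ball (fun p s hs => hC s hs p)).analyticAt
      (Metric.isOpen_ball.mem_nhds hz)

end remainder

/-! ### The sum over half of the lattice cone -/

/-- The term `n ^ (-s) m ^ (-e s) φ(n/m) ^ (-s)`, where the pair `p` is `(n - 1, m - n)` with
`m ≥ n ≥ 1`. -/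
noncomputable def halfTerm (e : ℕ) (φ : ℝ[X]) (s : ℂ) (p : ℕ × ℕ) : ℂ :=
  ((p.1 + 1 : ℕ) : ℂ) ^ (-s) * ((p.1 + 1 + p.2 : ℕ) : ℂ) ^ (-(e * s))
    * ((φ.eval (((p.1 + 1 : ℕ) : ℝ) / ((p.1 + 1 + p.2 : ℕ) : ℝ)) : ℝ) : ℂ) ^ (-s)

theorem hasSum_riemannZeta {z : ℂ} (hz : 1 < z.re) :
    HasSum (fun n : ℕ => ((n + 1 : ℕ) : ℂ) ^ (-z)) (riemannZeta z) := by
  rw [zeta_eq_tsum_one_div_nat_add_one_cpow hz]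
  have h := (summable_nat_add_iff 1).mpr (Complex.summable_one_div_nat_cpow.mpr hz)
  convert! h.hasSum using 1
  · funext n
    rw [Complex.cpow_neg, one_div]
  · simp

/-- Homogeneity of degree `-(e + 1) s`. -/
theorem halfTerm_eq (e : ℕ) (φ : ℝ[X]) (s : ℂ) (n l : ℕ) :
    halfTerm e φ s (n, l) = ((n + 1 : ℕ) : ℂ) ^ (-((e + 1) * s))
      * homDeriv e φ 0 s ((((n + 1 : ℕ) : ℝ) + l) / (n + 1 : ℕ)) := by
  have hν0 : (0 : ℝ) < ((n + 1 : ℕ) : ℝ) := by exact_mod_cast Nat.succ_pos n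
  have hνC : ((n + 1 : ℕ) : ℂ) ≠ 0 := Nat.cast_ne_zero.mpr n.succ_ne_zero
  have hl0 : (0 : ℝ) ≤ l := Nat.cast_nonneg _
  have hm : ((n + 1 + l : ℕ) : ℂ)
      = (((n + 1 : ℕ) : ℝ) : ℂ) * (((((n + 1 : ℕ) : ℝ) + l) / (n + 1 : ℕ) : ℝ) : ℂ) := by
    rw [← Complex.ofReal_mul, mul_div_cancel₀ _ hν0.ne']
    push_cast
    ring
  have h1 : ((n + 1 + l : ℕ) : ℂ) ^ (-(e * s)) = ((n + 1 : ℕ) : ℂ) ^ (-(e * s))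
      * (((((n + 1 : ℕ) : ℝ) + l) / (n + 1 : ℕ) : ℝ) : ℂ) ^ (-(e * s)) := by
    rw [hm, Complex.mul_cpow_ofReal_nonneg hν0.le (by positivity), Complex.ofReal_natCast]
  have h2 : ((n + 1 : ℕ) : ℝ) / ((n + 1 + l : ℕ) : ℝ)
      = ((((n + 1 : ℕ) : ℝ) + l) / (n + 1 : ℕ))⁻¹ := by
    rw [inv_div, Nat.cast_add (n + 1) l]
  have h3 : ((n + 1 : ℕ) : ℂ) ^ (-((e + 1) * s))
      = ((n + 1 : ℕ) : ℂ) ^ (-s) * ((n + 1 : ℕ) : ℂ) ^ (-(e * s)) := by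
    rw [← Complex.cpow_add _ _ hνC]
    congr 1
    ring
  rw [halfTerm, homDeriv_zero, h1, h2, h3]
  ring

theorem hasSum_halfTerm_diag {e : ℕ} {φ : ℝ[X]} {s : ℂ} (hs : 1 < ((e + 1) * s : ℂ).re) :
    HasSum (fun n => halfTerm e φ s (n, 0))
      (riemannZeta ((e + 1) * s) * ((φ.eval 1 : ℝ) : ℂ) ^ (-s)) := by
  refine ((hasSum_riemannZeta hs).mul_right (((φ.eval 1 : ℝ) : ℂ) ^ (-s))).congr_fun fun n => ?_
  have hν0 : (0 : ℝ) < ((n + 1 : ℕ) : ℝ) := by exact_mod_cast Nat.succ_pos n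
  rw [halfTerm_eq, Nat.cast_zero, add_zero, div_self hν0.ne']
  simp [homDeriv_zero]

section halfSum

variable {e : ℕ} {φ : ℝ[X]} (hφ : ∀ y : ℝ, 0 ≤ y → 0 < φ.eval y)
include hφ

theorem summable_halfTerm {s : ℂ} (hs : 2 / ((e : ℝ) + 1) < s.re) (he : 1 ≤ e) :
    Summable (halfTerm e φ s) := by
  have he1 : (1 : ℝ) ≤ e := by exact_mod_cast he
  have hs' : 2 < ((e : ℝ) + 1) * s.re := by
    rw [div_lt_iff₀ (by positivity)] at hs; linarith
  have hs0 : 0 < s.re := lt_of_le_of_lt (by positivity) hs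
  obtain ⟨C, hC0, hC⟩ := exists_norm_symbol_le (φ := φ) 1 0 hφ s 0
  set a : ℝ := ((e : ℝ) + 1) * s.re / 2 with ha
  have hsum : Summable fun n : ℕ => ((n + 1 : ℕ) : ℝ) ^ (-a) :=
    (summable_nat_add_iff 1).mpr (Real.summable_nat_rpow.mpr (by rw [ha]; linarith))
  have hprod := hsum.mul_of_nonneg hsum (fun n => Real.rpow_nonneg (Nat.cast_nonneg _) _)
    (fun n => Real.rpow_nonneg (Nat.cast_nonneg _) _)
  refine Summable.of_norm_bounded (hprod.mul_left C) fun p => ?_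
  set ν : ℝ := ((p.1 + 1 : ℕ) : ℝ) with hν
  set m : ℝ := ((p.1 + 1 + p.2 : ℕ) : ℝ) with hm
  have hν0 : 0 < ν := by rw [hν]; exact_mod_cast Nat.succ_pos _
  have hνm : ν ≤ m := by rw [hν, hm]; exact_mod_cast Nat.le_add_right _ _
  have hm0 : 0 < m := hν0.trans_le hνm
  have hlm : ((p.2 + 1 : ℕ) : ℝ) ≤ m := by rw [hm]; exact_mod_cast (by omega)
  have h1 := hC s (Metric.mem_closedBall_self le_rfl) (ν / m)
    ⟨by positivity, (div_le_one hm0).mpr hνm⟩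
  simp only [symbol, evalEval_one, mul_one, Nat.cast_zero, sub_zero] at h1
  have h2 : ‖((p.1 + 1 : ℕ) : ℂ) ^ (-s)‖ = ν ^ (-s.re) := by
    rw [Complex.norm_natCast_cpow_of_pos (Nat.succ_pos _), Complex.neg_re]
  have h3 : ‖((p.1 + 1 + p.2 : ℕ) : ℂ) ^ (-(e * s))‖ = m ^ (-(e * s.re)) := by
    rw [Complex.norm_natCast_cpow_of_pos (by omega)]
    simp [Complex.mul_re, hm]
  rw [halfTerm, norm_mul, norm_mul, h2, h3, mul_comm C]
  refine mul_le_mul ?_ h1 (norm_nonneg _) (by positivity)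
  -- part of the decay in `m` is traded for decay in `n ≤ m`
  have h4 : m ^ (-(e * s.re)) = m ^ (-(((e : ℝ) - 1) * s.re / 2)) * m ^ (-a) := by
    rw [← Real.rpow_add hm0, ha]; congr 1; ring
  have h5 : ν ^ (-a) = ν ^ (-(((e : ℝ) - 1) * s.re / 2)) * ν ^ (-s.re) := by
    rw [← Real.rpow_add hν0, ha]; congr 1; ring
  have h6 : m ^ (-(((e : ℝ) - 1) * s.re / 2)) ≤ ν ^ (-(((e : ℝ) - 1) * s.re / 2)) := by
    refine Real.rpow_le_rpow_of_nonpos hν0 hνm ?_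
    have : 0 ≤ ((e : ℝ) - 1) * s.re := mul_nonneg (by linarith) hs0.le
    linarith
  have h7 : m ^ (-a) ≤ ((p.2 + 1 : ℕ) : ℝ) ^ (-a) :=
    Real.rpow_le_rpow_of_nonpos (by exact_mod_cast Nat.succ_pos _) hlm (by rw [ha]; linarith)
  rw [h4, h5]
  calc _ = ν ^ (-s.re) * (m ^ (-(((e : ℝ) - 1) * s.re / 2)) * m ^ (-a)) := rfl
    _ ≤ ν ^ (-s.re) * (ν ^ (-(((e : ℝ) - 1) * s.re / 2)) * ((p.2 + 1 : ℕ) : ℝ) ^ (-a)) := by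
        gcongr
    _ = _ := by ring

/-- The functions to which the Euler–Maclaurin formula is applied: an antiderivative of
`x ^ (-e s) φ(1/x) ^ (-s)` that vanishes at infinity, followed by the derivatives. -/
noncomputable def eulerMaclaurinSeq (e : ℕ) (φ : ℝ[X]) (s : ℂ) : ℕ → ℝ → ℂ
  | 0, x => -∫ y in (0 : ℝ)..x⁻¹, (y : ℂ) ^ (e * s - 2 + (0 : ℕ)) * powDeriv φ 0 s y
  | k + 1, x => homDeriv e φ k s x

theorem hasDerivAt_eulerMaclaurinSeq {s : ℂ} (hs : 0 < (e * s - 1 + (0 : ℕ) : ℂ).re) (k : ℕ) {x : ℝ}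
    (hx : 0 < x) :
    HasDerivAt (eulerMaclaurinSeq e φ s k) (eulerMaclaurinSeq e φ s (k + 1) x) x := by
  cases k with
  | succ k => exact hasDerivAt_homDeriv e hφ k s hx
  | zero =>
    have hy : 0 < x⁻¹ := inv_pos.mpr hx
    have hcont : ∀ y : ℝ, 0 < y → ContinuousAt
        (fun y : ℝ => (y : ℂ) ^ (e * s - 2 + (0 : ℕ)) * powDeriv φ 0 s y) y := fun y hy =>
      (Complex.continuousAt_ofReal_cpow_const _ _ (Or.inr hy.ne')).mul
        (continuousAt_symbol_right _ 0 s (hφ y hy.le))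
    have h1 := intervalIntegral.integral_hasDerivAt_right
      (intervalIntegrable_rayIntegrand hφ 0 hs hy.le)
      (ContinuousOn.stronglyMeasurableAtFilter (s := Set.Ioi (0 : ℝ)) isOpen_Ioi
        (fun y hy => (hcont y hy).continuousWithinAt) x⁻¹ hy) (hcont _ hy)
    have h2 := (h1.scomp x (hasDerivAt_inv hx.ne')).neg
    convert! h2 using 1
    have hxC : (x : ℂ) ≠ 0 := by exact_mod_cast hx.ne'
    have harg : (x : ℂ).arg ≠ Real.pi := by
      rw [Complex.arg_ofReal_of_nonneg hx.le]; exact Real.pi_pos.ne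
    have h3 : ((x⁻¹ : ℝ) : ℂ) ^ (e * s - 2 + (0 : ℕ)) = (x : ℂ) ^ (-(e * s)) * (x : ℂ) ^ 2 := by
      rw [Complex.ofReal_inv, Complex.inv_cpow _ _ harg, ← Complex.cpow_neg,
        show -((e : ℂ) * s - 2 + (0 : ℕ)) = -(e * s) + (2 : ℕ) by push_cast; ring,
        Complex.cpow_add _ _ hxC, Complex.cpow_natCast]
    have h4 : powDeriv φ 0 s x⁻¹ = ((φ.eval x⁻¹ : ℝ) : ℂ) ^ (-s) := by
      simp [powDeriv_eq, derivPoly]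
    rw [h3, h4]
    simp only [eulerMaclaurinSeq, homDeriv_zero, Complex.real_smul]
    push_cast
    field_simp

theorem tendsto_eulerMaclaurinSeq {s : ℂ} (hs : 0 < (e * s - 1 + (0 : ℕ) : ℂ).re) (k : ℕ) :
    Tendsto (eulerMaclaurinSeq e φ s k) atTop (𝓝 0) := by
  cases k with
  | zero =>
    have h1 := intervalIntegral.continuousOn_primitive_interval' (b₁ := 0) (b₂ := 1) (a := 0)
      (intervalIntegrable_rayIntegrand hφ 0 hs zero_le_one) (by simp)
    have h2 := h1 0 (by simp)
    rw [Set.uIcc_of_le zero_le_one] at h2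
    have h3 : Tendsto (fun x : ℝ => x⁻¹) atTop (𝓝[Set.Icc 0 1] 0) := by
      refine tendsto_nhdsWithin_iff.mpr ⟨tendsto_inv_atTop_zero, ?_⟩
      filter_upwards [eventually_ge_atTop 1] with x hx
      exact ⟨inv_nonneg.mpr (by linarith), inv_le_one_of_one_le₀ hx⟩
    have h4 := (h2.tendsto.comp h3).neg
    rw [intervalIntegral.integral_same, neg_zero] at h4
    exact h4
  | succ k =>
    obtain ⟨C, hC0, hC⟩ := exists_norm_symbol_le (φ := φ)
      (homPoly (biMap φ) (e : ℂ[X]) (-X) k) k hφ s 0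
    have hpos : 0 < e * s.re + k := by
      have : (0 : ℝ) ≤ k := Nat.cast_nonneg k
      simp at hs
      linarith
    have h1 : Tendsto (fun x : ℝ => x ^ (-(e * s.re + k)) * C) atTop (𝓝 0) := by
      simpa using (tendsto_rpow_neg_atTop hpos).mul_const C
    refine squeeze_zero_norm' ?_ h1
    filter_upwards [eventually_ge_atTop 1] with x hx
    have hx0 : 0 < x := by linarith
    rw [eulerMaclaurinSeq, norm_homDeriv hx0, neg_add']
    exact mul_le_mul_of_nonneg_left (hC s (Metric.mem_closedBall_self le_rfl) x⁻¹
      ⟨inv_nonneg.mpr hx0.le, inv_le_one_of_one_le₀ hx⟩) (Real.rpow_nonneg hx0.le _)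

/-- Euler–Maclaurin summation over `m ≥ n`, for fixed `n`. -/
theorem tsum_halfTerm_row (he : 1 ≤ e) (M : ℕ) {s : ℂ} (hsM : s ∈ Metric.ball (0 : ℂ) M)
    (hs : 2 / ((e : ℝ) + 1) < s.re) (hs1 : 0 < (e * s - 1 + (0 : ℕ) : ℂ).re) (n : ℕ) :
    ∑' l, halfTerm e φ s (n, l) = halfTerm e φ s (n, 0) / 2
      - (-1) ^ ((e + 1) * M + 3 + 1) * ∑' l, remTerm e φ ((e + 1) * M + 3) s (n, l)
      - ∑ k ∈ Finset.range ((e + 1) * M + 3 + 2), eulerMaclaurinCoeff k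
          * eulerMaclaurinSeq e φ s k 1 * ((n + 1 : ℕ) : ℂ) ^ (-((e + 1) * s + (k - 1))) := by
  set K := (e + 1) * M + 3 with hK
  have hν0 : (0 : ℝ) < ((n + 1 : ℕ) : ℝ) := by exact_mod_cast Nat.succ_pos n
  have hνC : ((n + 1 : ℕ) : ℂ) ≠ 0 := Nat.cast_ne_zero.mpr n.succ_ne_zero
  have hh : Summable fun l => halfTerm e φ s (n, l) := (summable_halfTerm hφ hs he).prod_factor n
  have hh1 : Summable fun l => halfTerm e φ s (n, l + 1) := (summable_nat_add_iff 1).mpr hh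
  have hr : Summable fun l => remTerm e φ K s (n, l) := (summable_remTerm hφ M hsM).prod_factor n
  have hshift : halfTerm e φ s (n, 0) + ∑' l, halfTerm e φ s (n, l + 1)
      = ∑' l, halfTerm e φ s (n, l) := by
    simpa using hh.sum_add_tsum_nat_add 1
  have hlim := (tendsto_eulerMaclaurin (G := eulerMaclaurinSeq e φ s)
    (fun k x hx => hasDerivAt_eulerMaclaurinSeq hφ hs1 k (by linarith))
    (tendsto_eulerMaclaurinSeq hφ hs1) K hν0).const_mul
      (((n + 1 : ℕ) : ℂ) ^ (1 - ((e : ℂ) + 1) * s))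
  have hpow : ((n + 1 : ℕ) : ℂ) ^ (1 - ((e : ℂ) + 1) * s)
      = ((n + 1 : ℕ) : ℂ) ^ (-(((e : ℂ) + 1) * s)) * ((n + 1 : ℕ) : ℂ) := by
    rw [sub_eq_neg_add, Complex.cpow_add _ _ hνC, Complex.cpow_one]
  have hterm : ∀ N : ℕ, ((n + 1 : ℕ) : ℂ) ^ (1 - ((e : ℂ) + 1) * s) * ∑ l ∈ Finset.range N,
      ((eulerMaclaurinSeq e φ s 1 ((((n + 1 : ℕ) : ℝ) + l) / (n + 1 : ℕ))
          + eulerMaclaurinSeq e φ s 1 ((((n + 1 : ℕ) : ℝ) + l + 1) / (n + 1 : ℕ))) / 2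
          / (((n + 1 : ℕ) : ℝ) : ℂ)
        + (-1) ^ (K + 1) * eulerMaclaurinRem (K + 1)
          (fun x => eulerMaclaurinSeq e φ s (K + 2) (x / (n + 1 : ℕ))) (((n + 1 : ℕ) : ℝ) + l)
          / (((n + 1 : ℕ) : ℝ) : ℂ) ^ (K + 2))
      = ∑ l ∈ Finset.range N, ((halfTerm e φ s (n, l) + halfTerm e φ s (n, l + 1)) / 2
          + (-1) ^ (K + 1) * remTerm e φ K s (n, l)) := by
    intro N
    rw [Finset.mul_sum]
    refine Finset.sum_congr rfl fun l _ => ?_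
    rw [halfTerm_eq, halfTerm_eq, remTerm]
    have hl : ((n + 1 : ℕ) : ℝ) + ((l + 1 : ℕ) : ℝ) = ((n + 1 : ℕ) : ℝ) + l + 1 := by
      push_cast; ring
    rw [hl, Complex.ofReal_natCast]
    simp only [eulerMaclaurinSeq]
    rw [mul_add]
    congr 1
    · rw [hpow]
      field_simp
    · ring
  simp only [hterm] at hlim
  -- the same partial sums, evaluated by absolute convergence
  have hlim' := ((((hh.hasSum.add hh1.hasSum).div_const 2).add
    (hr.hasSum.mul_left ((-1) ^ (K + 1))))).tendsto_sum_nat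
  have huniq := tendsto_nhds_unique hlim' hlim
  have hrhs : ((n + 1 : ℕ) : ℂ) ^ (1 - ((e : ℂ) + 1) * s) * (-∑ k ∈ Finset.range (K + 2),
      eulerMaclaurinCoeff k * (eulerMaclaurinSeq e φ s k 1 / (((n + 1 : ℕ) : ℝ) : ℂ) ^ k))
      = -∑ k ∈ Finset.range (K + 2), eulerMaclaurinCoeff k
          * eulerMaclaurinSeq e φ s k 1 * ((n + 1 : ℕ) : ℂ) ^ (-((e + 1) * s + (k - 1))) := by
    rw [mul_neg, Finset.mul_sum]
    congr 1
    refine Finset.sum_congr rfl fun k _ => ?_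
    have : ((n + 1 : ℕ) : ℂ) ^ (-(((e : ℂ) + 1) * s + (k - 1)))
        = ((n + 1 : ℕ) : ℂ) ^ (1 - ((e : ℂ) + 1) * s) / ((n + 1 : ℕ) : ℂ) ^ k := by
      rw [← Complex.cpow_natCast _ k, ← Complex.cpow_sub _ _ hνC]
      congr 1
      ring
    rw [this, Complex.ofReal_natCast]
    ring
  rw [hrhs] at huniq
  linear_combination huniq - hshift / 2

/-- The meromorphic continuation, to the disc of radius `M` with `Re (e s - 1 + L) > 0`, of the sum
of `halfTerm e φ s` in which the terms with `m = n` have weight `1 / 2`. -/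
noncomputable def halfContinuation (e : ℕ) (φ : ℝ[X]) (M L : ℕ) (s : ℂ) : ℂ :=
  riemannZeta ((e + 1) * s + -1) * rayContinuation e φ L 0 s
    + ∑ j ∈ Finset.range ((e + 1) * M + 3), -eulerMaclaurinCoeff (j + 2)
        * (homDeriv e φ (j + 1) s 1 * riemannZeta ((e + 1) * s + (j + 1)))
    + -(-1) ^ ((e + 1) * M + 3 + 1) * ∑' p, remTerm e φ ((e + 1) * M + 3) s p

/-- The Euler–Maclaurin expansion of the half-sum. The last summand is half of the sum over the
diagonal. -/
theorem hasSum_halfTerm (he : 1 ≤ e) (M L : ℕ) {s : ℂ} (hsM : s ∈ Metric.ball (0 : ℂ) M)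
    (hs : 2 / ((e : ℝ) + 1) < s.re) :
    HasSum (halfTerm e φ s) (halfContinuation e φ M L s
      + riemannZeta ((e + 1) * s) * ((φ.eval 1 : ℝ) : ℂ) ^ (-s) / 2) := by
  have he1 : (1 : ℝ) ≤ e := by exact_mod_cast he
  have hD : 2 < ((e : ℝ) + 1) * s.re := by
    rw [div_lt_iff₀ (by positivity)] at hs; linarith
  have hDre : ((e + 1) * s : ℂ).re = ((e : ℝ) + 1) * s.re := by simp [Complex.mul_re]
  have hs1 : 0 < (e * s - 1 + (0 : ℕ) : ℂ).re := by
    have : (e * s - 1 + (0 : ℕ) : ℂ).re = e * s.re - 1 := by simp [Complex.mul_re]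
    rw [this]
    have hs0 : 0 < s.re := lt_of_le_of_lt (by positivity) hs
    nlinarith
  set K := (e + 1) * M + 3 with hK
  have hsum := summable_halfTerm hφ hs he
  have hrows : HasSum (fun n => ∑' l, halfTerm e φ s (n, l)) (∑' p, halfTerm e φ s p) :=
    hsum.hasSum.prod_fiberwise fun n => (hsum.prod_factor n).hasSum
  have hrem : HasSum (fun n => ∑' l, remTerm e φ K s (n, l)) (∑' p, remTerm e φ K s p) :=
    (summable_remTerm hφ M hsM).hasSum.prod_fiberwise fun n =>
      ((summable_remTerm hφ M hsM).prod_factor n).hasSum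
  have hzeta : ∀ k : ℕ, HasSum (fun n : ℕ => ((n + 1 : ℕ) : ℂ) ^ (-((e + 1) * s + ((k : ℂ) - 1))))
      (riemannZeta ((e + 1) * s + ((k : ℂ) - 1))) := fun k => hasSum_riemannZeta (by
    rw [Complex.add_re, hDre]
    have : (0 : ℝ) ≤ k := Nat.cast_nonneg k
    simp
    linarith)
  have hrhs := (((hasSum_halfTerm_diag (φ := φ) (s := s) (e := e)
    (by rw [hDre]; linarith)).div_const 2).sub (hrem.mul_left ((-1) ^ (K + 1)))).sub
    (hasSum_sum (s := Finset.range (K + 2)) fun k _ =>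
      (hzeta k).mul_left (eulerMaclaurinCoeff k * eulerMaclaurinSeq e φ s k 1))
  have huniq := hrows.unique (hrhs.congr_fun fun n => tsum_halfTerm_row hφ he M hsM hs hs1 n)
  have hval : halfContinuation e φ M L s
      + riemannZeta ((e + 1) * s) * ((φ.eval 1 : ℝ) : ℂ) ^ (-s) / 2 = ∑' p, halfTerm e φ s p := by
    rw [huniq, halfContinuation, ← hK, Finset.sum_range_succ' _ (K + 1), Finset.sum_range_succ' _ K,
      rayContinuation_eq hφ L 0 hs1]
    have h0 : eulerMaclaurinSeq e φ s 0 1 = -rayIntegral e φ 0 s := by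
      simp [eulerMaclaurinSeq, rayIntegral]
    have hc0 : eulerMaclaurinCoeff 0 = 1 := by simp [eulerMaclaurinCoeff]
    have hc1 : eulerMaclaurinCoeff 1 = 0 := by simp [eulerMaclaurinCoeff]
    have hsum : ∑ j ∈ Finset.range K, eulerMaclaurinCoeff (j + 1 + 1)
          * eulerMaclaurinSeq e φ s (j + 1 + 1) 1
          * riemannZeta ((e + 1) * s + (((j + 1 + 1 : ℕ) : ℂ) - 1))
        = -∑ j ∈ Finset.range K, -eulerMaclaurinCoeff (j + 2)
          * (homDeriv e φ (j + 1) s 1 * riemannZeta ((e + 1) * s + (j + 1))) := by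
      rw [← Finset.sum_neg_distrib]
      refine Finset.sum_congr rfl fun j _ => ?_
      have : (((j + 1 + 1 : ℕ) : ℂ) - 1) = j + 1 := by push_cast; ring
      rw [this, eulerMaclaurinSeq]
      ring
    rw [hsum, h0, hc0, zero_add, hc1, Nat.cast_zero, zero_sub]
    ring
  rw [hval]
  exact hsum.hasSum

end halfSum

/-! ### Poles of the continuation of half of the sum -/

/-- At `s = -p` the function `x ^ (-e s) φ(1/x) ^ (-s)` is a polynomial in `x` of degree at most
`e p`, so that its higher derivatives vanish. -/
theorem homDeriv_neg_natCast_eq_zero {e : ℕ} {φ : ℝ[X]} (hφ : ∀ y : ℝ, 0 ≤ y → 0 < φ.eval y)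
    (hdeg : φ.natDegree ≤ e) {p k : ℕ} (hk : e * p < k) {x : ℝ} (hx : 0 < x) :
    homDeriv e φ k (-(p : ℂ)) x = 0 := by
  set N : ℝ[X] := (reflect e φ) ^ p with hN
  have hder : ∀ k : ℕ, ∀ x : ℝ, 0 < x →
      homDeriv e φ k (-(p : ℂ)) x = (((derivative^[k] N).eval x : ℝ) : ℂ) := by
    intro k
    induction k with
    | zero =>
      intro x hx
      have hx' : (x : ℂ) ≠ 0 := by exact_mod_cast hx.ne'
      let _ : Invertible (x⁻¹ : ℝ) := invertibleOfNonzero (inv_ne_zero hx.ne')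
      have h1 := eval₂_reflect_mul_pow (RingHom.id ℝ) (x⁻¹ : ℝ) e φ hdeg
      rw [invOf_eq_inv, inv_inv, ← eval, ← eval] at h1
      have h2 : (reflect e φ).eval x = x ^ e * φ.eval x⁻¹ := by
        rw [← h1, inv_pow]
        field_simp
      have h3 : -((e : ℂ) * -(p : ℂ)) = ((e * p : ℕ) : ℂ) := by push_cast; ring
      rw [homDeriv_zero, h3, neg_neg, Complex.cpow_natCast, Complex.cpow_natCast,
        Function.iterate_zero, id, hN, eval_pow, h2]
      push_cast
      ring
    | succ k ih =>
      intro x hx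
      have h1 := hasDerivAt_homDeriv e hφ k (-(p : ℂ)) hx
      have h2 : HasDerivAt (fun x : ℝ => (((derivative^[k] N).eval x : ℝ) : ℂ))
          (((derivative^[k + 1] N).eval x : ℝ) : ℂ) x := by
        rw [Function.iterate_succ_apply']
        exact ((derivative^[k] N).hasDerivAt x).ofReal_comp
      refine h1.unique (h2.congr_of_eventuallyEq ?_)
      filter_upwards [lt_mem_nhds hx] with y hy using ih y hy
  have hNdeg : N.natDegree < k := by
    refine lt_of_le_of_lt (natDegree_pow_le.trans ?_) hk
    rw [mul_comm e p]
    refine Nat.mul_le_mul_left p ((natDegree_reflect_le).trans ?_)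
    simp [hdeg]
  rw [hder k x hx, iterate_derivative_eq_zero hNdeg, eval_zero, Complex.ofReal_zero]

section poles

variable {e : ℕ} {φ : ℝ[X]} (hφ : ∀ y : ℝ, 0 ≤ y → 0 < φ.eval y)
include hφ

theorem analyticAt_homDeriv_one (k : ℕ) (z : ℂ) :
    AnalyticAt ℂ (fun s => homDeriv e φ k s 1) z := by
  refine Differentiable.analyticAt ?_ z
  unfold homDeriv
  refine Differentiable.mul ?_ (differentiable_symbol _ _ (hφ _ (by simp)))
  exact Differentiable.const_cpow (by fun_prop) (Or.inl (by simp))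

theorem meromorphicAt_halfContinuation {M L : ℕ} {z : ℂ} (hzM : z ∈ Metric.ball (0 : ℂ) M)
    (hzL : 0 < (e * z - 1 + L : ℂ).re) : MeromorphicAt (halfContinuation e φ M L) z := by
  have hD : (e + 1 : ℂ) ≠ 0 := Nat.cast_add_one_ne_zero e
  refine MeromorphicAt.add (MeromorphicAt.add (MeromorphicAt.mul
    (meromorphicAt_riemannZeta_affine hD _ z)
    (meromorphicAt_rayContinuation hφ L 0 (by simpa using hzL))) ?_) ?_
  · refine MeromorphicAt.fun_sum fun j _ => ?_
    exact (MeromorphicAt.const _ z).mul ((analyticAt_homDeriv_one hφ (j + 1) z).meromorphicAt.mul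
      (meromorphicAt_riemannZeta_affine hD _ z))
  · exact (MeromorphicAt.const _ z).mul (analyticAt_tsum_remTerm hφ M hzM).meromorphicAt

/-- Only the continued ray integral contributes to the residue: where the pole of a boundary term
`ζ((e + 1) s + j + 1)` falls on `s = (1 - n) / e`, this point is an integer `-p`, and the
derivative multiplying the zeta function vanishes there. -/
theorem hasSimplePoleAt_halfContinuation (he : 2 ≤ e) (hdeg : φ.natDegree ≤ e) {M n : ℕ} {z : ℂ}
    (hz : e * z = 1 - n) (hzM : z ∈ Metric.ball (0 : ℂ) M) :
    HasSimplePoleAt (halfContinuation e φ M (n + 1)) z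
      (riemannZeta ((e + 1) * z + -1) * (1 / e * (powDeriv φ n z 0 / n.factorial))) := by
  have hD : (e + 1 : ℂ) ≠ 0 := Nat.cast_add_one_ne_zero e
  have he0 : (e : ℂ) ≠ 0 := Nat.cast_ne_zero.mpr (by omega)
  have hDz : (e : ℂ) * ((e + 1) * z) = (e + 1) * (1 - n) := by rw [← hz]; ring
  have h1 : (e + 1) * z + -1 ≠ 1 := by
    intro h
    have h2 : ((e : ℂ) + 1) * (1 - n) = e * 2 := by
      rw [← hDz]; linear_combination (e : ℂ) * h
    have h3 : ((e : ℤ) + 1) * (1 - n) = e * 2 := by exact_mod_cast h2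
    rcases Nat.eq_zero_or_pos n with hn | hn
    · subst hn; push_cast at h3; omega
    · have : ((e : ℤ) + 1) * (1 - n) ≤ 0 :=
        mul_nonpos_of_nonneg_of_nonpos (by omega) (by omega)
      omega
  have hray := (hasSimplePoleAt_rayContinuation hφ (by omega : e ≠ 0) n 0 (z := z)
    (by rw [hz]; push_cast; ring)).mul_analyticAt (analyticAt_riemannZeta_affine h1)
  rw [zero_add] at hray
  have hsum : HasSimplePoleAt (fun s => ∑ j ∈ Finset.range ((e + 1) * M + 3),
      -eulerMaclaurinCoeff (j + 2)
        * (homDeriv e φ (j + 1) s 1 * riemannZeta ((e + 1) * s + (j + 1)))) z 0 := by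
    refine HasSimplePoleAt.sum _ fun j _ => ?_
    have ha := analyticAt_homDeriv_one (e := e) hφ (j + 1) z
    by_cases hj : ((e : ℂ) + 1) * z + (j + 1) = 1
    · have h2 : ((e : ℂ) + 1) * (n - 1) = e * j := by
        linear_combination hDz - (e : ℂ) * hj
      have h3 : ((e : ℤ) + 1) * (n - 1) = e * j := by exact_mod_cast h2
      have hn : 1 ≤ n := by
        by_contra hn
        have hn0 : n = 0 := by omega
        subst hn0
        have : (0 : ℤ) ≤ e * j := by positivity
        push_cast at h3
        omega
      have h4 : (e : ℤ) * (j + 1 - n) = n - 1 := by linear_combination -h3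
      have hnj : n ≤ j + 1 := by
        by_contra hlt
        have : (e : ℤ) * (j + 1 - n) < 0 := mul_neg_of_pos_of_neg (by omega) (by omega)
        omega
      have hzp : z = -((j + 1 - n : ℕ) : ℂ) := by
        rw [Nat.cast_sub hnj]
        push_cast
        linear_combination hj - hz
      have hlt : e * (j + 1 - n) < j + 1 := by
        zify [hnj]
        rw [h4]
        omega
      have h5 := (hasSimplePoleAt_riemannZeta_affine hD hj).mul_analyticAt
        ((analyticAt_const (v := -eulerMaclaurinCoeff (j + 2))).mul ha)
      have h6 : homDeriv e φ (j + 1) z 1 = 0 := by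
        rw [hzp]
        exact homDeriv_neg_natCast_eq_zero hφ hdeg hlt one_pos
      simp only [Pi.mul_apply, h6, mul_zero, zero_mul] at h5
      exact h5.congr (Eventually.of_forall fun s => by ring)
    · exact HasSimplePoleAt.of_analyticAt
        (analyticAt_const.mul (ha.mul (analyticAt_riemannZeta_affine hj)))
  have hrem := HasSimplePoleAt.of_analyticAt
    ((analyticAt_const (v := -(-1 : ℂ) ^ ((e + 1) * M + 3 + 1))).mul
      (analyticAt_tsum_remTerm (e := e) hφ M hzM))
  have := (hray.add hsum).add hrem
  simp only [add_zero] at this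
  exact this

end poles

/-! ### Double series split along the diagonal -/

/-- The polynomial `c φ(μ y)`. -/
noncomputable def scaledPoly (φ : ℝ[X]) (c μ : ℝ) : ℝ[X] := C c * φ.comp (C μ * X)

theorem scaledPoly_eval (φ : ℝ[X]) (c μ y : ℝ) :
    (scaledPoly φ c μ).eval y = c * φ.eval (μ * y) := by
  simp [scaledPoly]

theorem scaledPoly_eval_pos {φ : ℝ[X]} (hφ : ∀ y : ℝ, 0 ≤ y → 0 < φ.eval y) {c μ : ℝ} (hc : 0 < c)
    (hμ : 0 ≤ μ) (y : ℝ) (hy : 0 ≤ y) : 0 < (scaledPoly φ c μ).eval y := by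
  rw [scaledPoly_eval]
  exact mul_pos hc (hφ _ (mul_nonneg hμ hy))

theorem natDegree_scaledPoly_le (φ : ℝ[X]) (c μ : ℝ) :
    (scaledPoly φ c μ).natDegree ≤ φ.natDegree := by
  refine (natDegree_C_mul_le _ _).trans (natDegree_comp_le.trans ?_)
  calc _ ≤ φ.natDegree * 1 := Nat.mul_le_mul_left _ 
        ((natDegree_C_mul_le μ X).trans natDegree_X_le)
    _ = _ := mul_one _

/-- The Taylor coefficient that occurs in the residue of half of the sum. -/
theorem powDeriv_scaledPoly_zero {φ : ℝ[X]} (h0 : φ.eval 0 = 1) {c : ℝ} (hc : 0 < c) (μ : ℝ)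
    (α : ℝ) (n : ℕ) :
    powDeriv (scaledPoly φ c μ) n (-(α : ℂ)) 0 / n.factorial
      = (c : ℂ) ^ (α : ℂ) * (μ : ℂ) ^ n
        * (expansionCoeff (fun y => (φ.eval y) ^ α) n : ℂ) := by
  have hcC : (c : ℂ) ≠ 0 := by exact_mod_cast hc.ne'
  have hmap : (scaledPoly φ c μ).map Complex.ofRealHom
      = C (c : ℂ) * (φ.map Complex.ofRealHom).comp (C (μ : ℂ) * X) := by
    simp [scaledPoly, Polynomial.map_comp]
  have hd : (derivPoly (φ.map Complex.ofRealHom) (α : ℂ) n).eval 0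
      = (((derivPoly φ α n).eval 0 : ℝ) : ℂ) := by
    have := derivPoly_map Complex.ofRealHom φ α n
    rw [Complex.ofRealHom_eq_coe] at this
    rw [← this, eval_zero_map, Complex.ofRealHom_eq_coe]
  rw [powDeriv_eq, hmap, neg_neg, derivPoly_scale, scaledPoly_eval, mul_zero, h0, mul_one,
    expansionCoeff_rpow_eval φ α n h0, eval_mul, eval_C, eval_comp]
  simp only [Complex.ofReal_zero, eval_mul, eval_C, eval_X, mul_zero, hd]
  rw [Complex.cpow_sub _ _ hcC, Complex.cpow_natCast]
  push_cast
  field_simp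

/-- The two halves of a double series cover it, with the diagonal covered twice. -/
theorem hasSum_of_halves {f : ℕ+ × ℕ+ → ℂ} {a₁ a₂ d : ℂ}
    (h₁ : HasSum (fun p : ℕ × ℕ => f ((p.1 + p.2).succPNat, p.1.succPNat)) a₁)
    (h₂ : HasSum (fun p : ℕ × ℕ => f (p.1.succPNat, (p.1 + p.2).succPNat)) a₂)
    (hd : HasSum (fun n : ℕ => f (n.succPNat, n.succPNat)) d) :
    HasSum f (a₁ + a₂ - d) := by
  classical
  have hsucc : ∀ m : ℕ+, (m.natPred).succPNat = m := PNat.succPNat_natPred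
  let i₁ : ℕ × ℕ → ℕ+ × ℕ+ := fun p => ((p.1 + p.2).succPNat, p.1.succPNat)
  let i₂ : ℕ × ℕ → ℕ+ × ℕ+ := fun p => (p.1.succPNat, (p.1 + p.2).succPNat)
  let i₀ : ℕ → ℕ+ × ℕ+ := fun n => (n.succPNat, n.succPNat)
  have hi₁ : Function.Injective i₁ := by
    rintro ⟨a, b⟩ ⟨c, d⟩ h
    simp only [i₁, Prod.mk.injEq, Nat.succPNat_inj] at h
    ext <;> simp <;> omega
  have hi₂ : Function.Injective i₂ := by
    rintro ⟨a, b⟩ ⟨c, d⟩ h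
    simp only [i₂, Prod.mk.injEq, Nat.succPNat_inj] at h
    ext <;> simp <;> omega
  have hi₀ : Function.Injective i₀ := by
    intro a b h
    simpa only [i₀, Prod.mk.injEq, Nat.succPNat_inj, and_self] using h
  have k₁ : HasSum (fun q : ℕ+ × ℕ+ => if q.2 ≤ q.1 then f q else 0) a₁ := by
    rw [← hi₁.hasSum_iff]
    · refine h₁.congr_fun fun p => ?_
      have : (i₁ p).2 ≤ (i₁ p).1 := by
        simp only [i₁, Nat.succPNat_le_succPNat]; omega
      simp only [Function.comp, if_pos this]
      rfl
    · intro q hq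
      rw [if_neg]
      intro hle
      refine hq ⟨(q.2.natPred, q.1.natPred - q.2.natPred), ?_⟩
      have : q.2.natPred ≤ q.1.natPred := PNat.natPred_le_natPred.mpr hle
      simp only [i₁, Nat.add_sub_cancel' this, hsucc]
  have k₂ : HasSum (fun q : ℕ+ × ℕ+ => if q.1 ≤ q.2 then f q else 0) a₂ := by
    rw [← hi₂.hasSum_iff]
    · refine h₂.congr_fun fun p => ?_
      have : (i₂ p).1 ≤ (i₂ p).2 := by
        simp only [i₂, Nat.succPNat_le_succPNat]; omega
      simp only [Function.comp, if_pos this]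
      rfl
    · intro q hq
      rw [if_neg]
      intro hle
      refine hq ⟨(q.1.natPred, q.2.natPred - q.1.natPred), ?_⟩
      have : q.1.natPred ≤ q.2.natPred := PNat.natPred_le_natPred.mpr hle
      simp only [i₂, Nat.add_sub_cancel' this, hsucc]
  have k₀ : HasSum (fun q : ℕ+ × ℕ+ => if q.1 = q.2 then f q else 0) d := by
    rw [← hi₀.hasSum_iff]
    · refine hd.congr_fun fun p => ?_
      simp only [Function.comp, i₀, if_true]
    · intro q hq
      rw [if_neg]
      intro heq
      refine hq ⟨q.1.natPred, ?_⟩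
      simp only [i₀, hsucc]
      exact Prod.ext rfl heq
  refine ((k₁.add k₂).sub k₀).congr_fun fun q => ?_
  rcases lt_trichotomy q.1 q.2 with h | h | h
  · simp [h.le, h.ne, not_le.mpr h]
  · simp [h]
  · simp [h.le, h.ne', not_le.mpr h]

/-- The double series with terms `m ^ (-e s) n ^ (-s) (c₁ φ(μ₁ n/m)) ^ (-s)`, which are also
`n ^ (-e s) m ^ (-s) (c₂ φ(μ₂ m/n)) ^ (-s)`. The first form is used for `m ≥ n` and the second for
`n ≥ m`, so that the argument of `φ` is in `[0, max μ₁ μ₂]`. -/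
structure ConeSeries (e : ℕ) (φ : ℝ[X]) (c₁ μ₁ c₂ μ₂ : ℝ) (term : ℂ → ℕ+ × ℕ+ → ℂ) : Prop where
  two_le : 2 ≤ e
  natDegree_le : φ.natDegree ≤ e
  eval_pos : ∀ y : ℝ, 0 ≤ y → 0 < φ.eval y
  eval_zero : φ.eval 0 = 1
  pos₁ : 0 < c₁
  nonneg₁ : 0 ≤ μ₁
  pos₂ : 0 < c₂
  nonneg₂ : 0 ≤ μ₂
  term₁ : ∀ s n l, term s ((n + l).succPNat, n.succPNat)
    = halfTerm e (scaledPoly φ c₁ μ₁) s (n, l)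
  term₂ : ∀ s n l, term s (n.succPNat, (n + l).succPNat)
    = halfTerm e (scaledPoly φ c₂ μ₂) s (n, l)

namespace ConeSeries

variable {e : ℕ} {φ : ℝ[X]} {c₁ μ₁ c₂ μ₂ : ℝ} {term : ℂ → ℕ+ × ℕ+ → ℂ}
  (S : ConeSeries e φ c₁ μ₁ c₂ μ₂ term)
include S

theorem hasSum {M L : ℕ} {s : ℂ} (hsM : s ∈ Metric.ball (0 : ℂ) M)
    (hs : 2 / ((e : ℝ) + 1) < s.re) :
    HasSum (term s) (halfContinuation e (scaledPoly φ c₁ μ₁) M L s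
      + halfContinuation e (scaledPoly φ c₂ μ₂) M L s) := by
  have he : 1 ≤ e := one_le_two.trans S.two_le
  have h₁ := hasSum_halfTerm (scaledPoly_eval_pos S.eval_pos S.pos₁ S.nonneg₁) he M L hsM hs
  have h₂ := hasSum_halfTerm (scaledPoly_eval_pos S.eval_pos S.pos₂ S.nonneg₂) he M L hsM hs
  have hre : 1 < ((e + 1) * s : ℂ).re := by
    have : ((e + 1) * s : ℂ).re = ((e : ℝ) + 1) * s.re := by simp [Complex.mul_re]
    rw [this]
    rw [div_lt_iff₀ (by positivity)] at hs
    linarith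
  have hd₁ := hasSum_halfTerm_diag (e := e) (φ := scaledPoly φ c₁ μ₁) hre
  have hd₂ := hasSum_halfTerm_diag (e := e) (φ := scaledPoly φ c₂ μ₂) hre
  have hdiag := hd₁.unique (hd₂.congr_fun fun n => by rw [← S.term₁, ← S.term₂, add_zero])
  rw [← hdiag] at h₂
  have := hasSum_of_halves (f := term s) (h₁.congr_fun fun p => S.term₁ s p.1 p.2)
    (h₂.congr_fun fun p => S.term₂ s p.1 p.2) (hd₁.congr_fun fun n => by
      rw [← S.term₁, add_zero])
  convert! this using 1
  ring

theorem meromorphicAt {M L : ℕ} {z : ℂ} (hzM : z ∈ Metric.ball (0 : ℂ) M)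
    (hzL : 0 < (e * z - 1 + L : ℂ).re) :
    MeromorphicAt (fun s => halfContinuation e (scaledPoly φ c₁ μ₁) M L s
      + halfContinuation e (scaledPoly φ c₂ μ₂) M L s) z :=
  (meromorphicAt_halfContinuation (scaledPoly_eval_pos S.eval_pos S.pos₁ S.nonneg₁) hzM hzL).add
    (meromorphicAt_halfContinuation (scaledPoly_eval_pos S.eval_pos S.pos₂ S.nonneg₂) hzM hzL)

theorem exists_continuation :
    ∃ Ω : ℂ → ℂ, IsMeromorphicContinuation term (2 / ((e : ℝ) + 1)) Ω := by
  refine exists_isMeromorphicContinuation fun M => ⟨fun s =>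
    halfContinuation e (scaledPoly φ c₁ μ₁) M (e * M + 2) s
      + halfContinuation e (scaledPoly φ c₂ μ₂) M (e * M + 2) s, fun z hz => ?_,
    fun s hsM hs => S.hasSum hsM hs⟩
  refine S.meromorphicAt hz ?_
  have hre : |z.re| ≤ M := (Complex.abs_re_le_norm z).trans (mem_ball_zero_iff.mp hz).le
  have h1 : (e : ℝ) * (-z.re) ≤ e * M :=
    mul_le_mul_of_nonneg_left (by linarith [(abs_le.mp hre).1]) (Nat.cast_nonneg e)
  have h2 : (e * z - 1 + (e * M + 2 : ℕ) : ℂ).re = e * z.re - 1 + (e * M + 2) := by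
    simp [Complex.mul_re]
  rw [h2]
  linarith

theorem hasResidueAt {Ω : ℂ → ℂ} (hΩ : IsMeromorphicContinuation term (2 / ((e : ℝ) + 1)) Ω)
    (n : ℕ) :
    HasResidueAt Ω ((1 - (n : ℂ)) / e) (1 / e * riemannZeta ((e + 1) * ((1 - (n : ℂ)) / e) - 1)
      * ((c₁ : ℂ) ^ (((n : ℂ) - 1) / e) * (μ₁ : ℂ) ^ n
        + (c₂ : ℂ) ^ (((n : ℂ) - 1) / e) * (μ₂ : ℂ) ^ n)
      * (expansionCoeff (fun y => (φ.eval y) ^ (((n : ℝ) - 1) / e)) n : ℂ)) := by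
  have he := S.two_le
  have he0 : (e : ℂ) ≠ 0 := Nat.cast_ne_zero.mpr (by omega)
  have heR : (0 : ℝ) < e := by exact_mod_cast (by omega : 0 < e)
  set z : ℂ := (1 - (n : ℂ)) / e with hz
  have hez : e * z = 1 - n := by rw [hz]; field_simp
  obtain ⟨M, hM⟩ := exists_nat_gt (max ‖z‖ 2)
  have hzM : z ∈ Metric.ball (0 : ℂ) M := by
    rw [mem_ball_zero_iff]; exact (le_max_left _ _).trans_lt hM
  have hM2 : (2 : ℝ) < M := (le_max_right _ _).trans_lt hM
  let F : ℂ → ℂ := fun s => halfContinuation e (scaledPoly φ c₁ μ₁) M (n + 1) s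
    + halfContinuation e (scaledPoly φ c₂ μ₂) M (n + 1) s
  -- `n + 1` integrations by parts suffice for the pole at `z`, where `Re (e z - 1) = -n`
  let U : Set ℂ := Metric.ball 0 M ∩ {s | 0 < (e * s - 1 + (n + 1 : ℕ) : ℂ).re}
  have hUeq : {s : ℂ | 0 < (e * s - 1 + (n + 1 : ℕ) : ℂ).re} = {s : ℂ | -n / e < s.re} := by
    ext s
    have : (e * s - 1 + (n + 1 : ℕ) : ℂ).re = e * s.re + n := by simp [Complex.mul_re]
    simp only [Set.mem_ofPred_eq, this]
    rw [div_lt_iff₀ heR]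
    constructor <;> intro h <;> linarith
  have hUo : IsOpen U := Metric.isOpen_ball.inter
    (isOpen_lt continuous_const (by fun_prop))
  have hUc : IsPreconnected U := by
    refine Convex.isPreconnected ((convex_ball _ _).inter ?_)
    rw [hUeq]
    exact convex_halfSpace_re_gt _
  have hzU : z ∈ U := by
    refine ⟨hzM, ?_⟩
    have : (e * z - 1 + (n + 1 : ℕ) : ℂ) = 1 := by rw [hez]; push_cast; ring
    simp only [Set.mem_ofPred_eq, this]
    simp
  have hx : ((2 : ℝ) : ℂ) ∈ U := by
    refine ⟨?_, ?_⟩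
    · rw [mem_ball_zero_iff, Complex.norm_real]; simpa using hM2
    · rw [hUeq]
      have h1 : -(n : ℝ) / e ≤ 0 := div_nonpos_of_nonpos_of_nonneg (by simp) heR.le
      simp only [Set.mem_ofPred_eq, Complex.ofReal_re]
      linarith
  have hσ : 2 / ((e : ℝ) + 1) < ((2 : ℝ) : ℂ).re := by
    rw [Complex.ofReal_re, div_lt_iff₀ (by positivity)]
    linarith
  have hΩF : Ω =ᶠ[𝓝[≠] z] F :=
    MeromorphicOn.eventuallyEq_of_eq_halfPlane hUc hUo (fun w _ => hΩ.1 w)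
      (fun w hw => S.meromorphicAt hw.1 hw.2) hx hσ
      (fun s hs hre => (hΩ.2 s hre).unique (S.hasSum hs.1 hre)) hzU
  have hα : z = -(((((n : ℝ) - 1) / e : ℝ)) : ℂ) := by
    rw [hz]; push_cast; ring
  have hα' : (((((n : ℝ) - 1) / e : ℝ)) : ℂ) = ((n : ℂ) - 1) / e := by push_cast; ring
  have h₁ := hasSimplePoleAt_halfContinuation (scaledPoly_eval_pos S.eval_pos S.pos₁ S.nonneg₁) he
    ((natDegree_scaledPoly_le φ c₁ μ₁).trans S.natDegree_le) hez hzM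
  have h₂ := hasSimplePoleAt_halfContinuation (scaledPoly_eval_pos S.eval_pos S.pos₂ S.nonneg₂) he
    ((natDegree_scaledPoly_le φ c₂ μ₂).trans S.natDegree_le) hez hzM
  have hp₁ := powDeriv_scaledPoly_zero S.eval_zero S.pos₁ μ₁ (((n : ℝ) - 1) / e) n
  have hp₂ := powDeriv_scaledPoly_zero S.eval_zero S.pos₂ μ₂ (((n : ℝ) - 1) / e) n
  rw [← hα] at hp₁ hp₂
  rw [hp₁] at h₁
  rw [hp₂] at h₂
  have h := ((h₁.add h₂).congr hΩF).hasResidueAt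
  convert! h using 1
  rw [hα', sub_eq_add_neg ((e + 1) * z) 1]
  ring

end ConeSeries

/-! ### The series `ω_B` and `ω_G` -/

theorem ofReal_mul_cpow {a b : ℝ} (ha : 0 ≤ a) (hb : 0 ≤ b) (s : ℂ) :
    ((a * b : ℝ) : ℂ) ^ s = (a : ℂ) ^ s * (b : ℂ) ^ s := by
  rw [Complex.ofReal_mul, Complex.mul_cpow_ofReal_nonneg ha hb]

theorem ofReal_pow_cpow {a : ℝ} (ha : 0 ≤ a) (k : ℕ) (s : ℂ) :
    ((a ^ k : ℝ) : ℂ) ^ s = (a : ℂ) ^ (k * s) := by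
  induction k with
  | zero => simp
  | succ k ih =>
    rw [pow_succ, ofReal_mul_cpow (by positivity) ha, ih, Complex.cpow_nat_mul,
      Complex.cpow_nat_mul, pow_succ]

theorem halfTerm_eq_ofReal_cpow (e : ℕ) {φ : ℝ[X]} (hφ : ∀ y : ℝ, 0 ≤ y → 0 < φ.eval y) (s : ℂ)
    (n l : ℕ) : halfTerm e φ s (n, l)
      = ((((n + 1 : ℕ) : ℝ) * ((n + 1 + l : ℕ) : ℝ) ^ e
        * φ.eval (((n + 1 : ℕ) : ℝ) / ((n + 1 + l : ℕ) : ℝ)) : ℝ) : ℂ) ^ (-s) := by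
  have h := hφ (((n + 1 : ℕ) : ℝ) / ((n + 1 + l : ℕ) : ℝ)) (by positivity)
  rw [ofReal_mul_cpow (by positivity) h.le, ofReal_mul_cpow (by positivity) (by positivity),
    ofReal_pow_cpow (by positivity), mul_neg, halfTerm, Complex.ofReal_natCast,
    Complex.ofReal_natCast]

theorem omegaBTerm_eq_ofReal_cpow (s : ℂ) (p : ℕ+ × ℕ+) {m n : ℝ} (hm : ((p.1 : ℕ) : ℝ) = m)
    (hn : ((p.2 : ℕ) : ℝ) = n) :
    omegaBTerm s p = ((m * n * (m + n) * (m + 2 * n) : ℝ) : ℂ) ^ (-s) := by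
  have hm0 : 0 ≤ m := hm ▸ Nat.cast_nonneg _
  have hn0 : 0 ≤ n := hn ▸ Nat.cast_nonneg _
  rw [omegaBTerm, Complex.cpow_neg, ofReal_mul_cpow (by positivity) (by positivity),
    ofReal_mul_cpow (by positivity) (by positivity),
    ofReal_mul_cpow (by positivity) (by positivity), ← hm, ← hn]
  push_cast
  rw [one_div]

theorem omegaGTerm_eq_ofReal_cpow (s : ℂ) (p : ℕ+ × ℕ+) {m n : ℝ} (hm : ((p.1 : ℕ) : ℝ) = m)
    (hn : ((p.2 : ℕ) : ℝ) = n) :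
    omegaGTerm s p = ((m * n * (m + n) * (m + 2 * n) * (m + 3 * n) * (2 * m + 3 * n) : ℝ) : ℂ)
      ^ (-s) := by
  have hm0 : 0 ≤ m := hm ▸ Nat.cast_nonneg _
  have hn0 : 0 ≤ n := hn ▸ Nat.cast_nonneg _
  rw [omegaGTerm, Complex.cpow_neg, ofReal_mul_cpow (by positivity) (by positivity),
    ofReal_mul_cpow (by positivity) (by positivity),
    ofReal_mul_cpow (by positivity) (by positivity),
    ofReal_mul_cpow (by positivity) (by positivity),
    ofReal_mul_cpow (by positivity) (by positivity), ← hm, ← hn]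
  push_cast
  rw [one_div]

theorem phiB_eval_pos (y : ℝ) (hy : 0 ≤ y) : 0 < (phiB ℝ).eval y := by
  simp only [phiB, eval_mul, eval_add, eval_one, eval_X, eval_C]
  positivity

theorem phiG_eval_pos (y : ℝ) (hy : 0 ≤ y) : 0 < (phiG ℝ).eval y := by
  simp only [phiG, eval_mul, eval_add, eval_one, eval_X, eval_C]
  positivity

theorem cast_succPNat (n : ℕ) : (((n.succPNat : ℕ+) : ℕ) : ℝ) = ((n + 1 : ℕ) : ℝ) := rfl

theorem cast_add_succPNat (n l : ℕ) :
    ((((n + l).succPNat : ℕ+) : ℕ) : ℝ) = ((n + 1 + l : ℕ) : ℝ) := by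
  rw [Nat.succPNat_coe]
  congr 1
  omega

/-- The substitution `y ↦ y / 2` exchanges the two factors of `phiB`, up to the constant `2`. -/
theorem coneSeries_omegaB : ConeSeries 3 (phiB ℝ) 1 1 2 (1 / 2) omegaBTerm where
  two_le := by norm_num
  natDegree_le := by
    rw [phiB]
    compute_degree
    norm_num
  eval_pos := phiB_eval_pos
  eval_zero := by simp [phiB]
  pos₁ := one_pos
  nonneg₁ := zero_le_one
  pos₂ := two_pos
  nonneg₂ := by norm_num
  term₁ s n l := by
    have hm : (0 : ℝ) < ((n + 1 + l : ℕ) : ℝ) := by exact_mod_cast (by omega)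
    rw [omegaBTerm_eq_ofReal_cpow s _ (cast_add_succPNat n l) (cast_succPNat n),
      halfTerm_eq_ofReal_cpow 3 (scaledPoly_eval_pos phiB_eval_pos one_pos zero_le_one),
      scaledPoly_eval]
    congr 2
    simp only [phiB, eval_mul, eval_add, eval_one, eval_X, eval_C]
    field_simp
  term₂ s n l := by
    have hm : (0 : ℝ) < ((n + 1 + l : ℕ) : ℝ) := by exact_mod_cast (by omega)
    rw [omegaBTerm_eq_ofReal_cpow s _ (cast_succPNat n) (cast_add_succPNat n l),
      halfTerm_eq_ofReal_cpow 3 (scaledPoly_eval_pos phiB_eval_pos two_pos (by norm_num)),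
      scaledPoly_eval]
    congr 2
    simp only [phiB, eval_mul, eval_add, eval_one, eval_X, eval_C]
    field_simp
    ring

/-- The substitution `y ↦ y / 3` permutes the factors of `phiG`, up to constants. -/
theorem coneSeries_omegaG : ConeSeries 5 (phiG ℝ) 2 1 18 (1 / 3) omegaGTerm where
  two_le := by norm_num
  natDegree_le := by
    rw [phiG]
    compute_degree
    norm_num
  eval_pos := phiG_eval_pos
  eval_zero := by simp [phiG]
  pos₁ := two_pos
  nonneg₁ := zero_le_one
  pos₂ := by norm_num
  nonneg₂ := by norm_num
  term₁ s n l := by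
    have hm : (0 : ℝ) < ((n + 1 + l : ℕ) : ℝ) := by exact_mod_cast (by omega)
    rw [omegaGTerm_eq_ofReal_cpow s _ (cast_add_succPNat n l) (cast_succPNat n),
      halfTerm_eq_ofReal_cpow 5 (scaledPoly_eval_pos phiG_eval_pos two_pos zero_le_one),
      scaledPoly_eval]
    congr 2
    simp only [phiG, eval_mul, eval_add, eval_one, eval_X, eval_C]
    field_simp
  term₂ s n l := by
    have hm : (0 : ℝ) < ((n + 1 + l : ℕ) : ℝ) := by exact_mod_cast (by omega)
    rw [omegaGTerm_eq_ofReal_cpow s _ (cast_succPNat n) (cast_add_succPNat n l),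
      halfTerm_eq_ofReal_cpow 5 (scaledPoly_eval_pos phiG_eval_pos (by norm_num) (by norm_num)),
      scaledPoly_eval]
    congr 2
    simp only [phiG, eval_mul, eval_add, eval_one, eval_X, eval_C]
    field_simp
    ring

theorem two_cpow_mul_half_pow (n : ℕ) :
    (2 : ℂ) ^ (((n : ℂ) - 1) / 3) * (1 / 2 : ℂ) ^ n = (2 : ℂ) ^ ((-1 - 2 * (n : ℂ)) / 3) := by
  have h2 : (2 : ℂ) ≠ 0 := two_ne_zero
  rw [one_div, inv_pow, ← Complex.cpow_natCast, ← Complex.cpow_neg, ← Complex.cpow_add _ _ h2]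
  congr 1
  ring

theorem eighteen_cpow_mul_third_pow (n : ℕ) :
    (18 : ℂ) ^ (((n : ℂ) - 1) / 5) * (1 / 3 : ℂ) ^ n
      = (2 : ℂ) ^ (((n : ℂ) - 1) / 5) * (3 : ℂ) ^ ((-3 * (n : ℂ) - 2) / 5) := by
  have h3 : (3 : ℂ) ≠ 0 := three_ne_zero
  have h18 : (18 : ℂ) ^ (((n : ℂ) - 1) / 5)
      = (2 : ℂ) ^ (((n : ℂ) - 1) / 5) * (3 : ℂ) ^ (((2 : ℕ) : ℂ) * (((n : ℂ) - 1) / 5)) := by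
    have h := ofReal_mul_cpow (a := 2) (b := 3 ^ 2) (by norm_num) (by norm_num) (((n : ℂ) - 1) / 5)
    rw [ofReal_pow_cpow (by norm_num)] at h
    norm_num at h ⊢
    exact h
  rw [h18, one_div, inv_pow, ← Complex.cpow_natCast, ← Complex.cpow_neg, mul_assoc,
    ← Complex.cpow_add _ _ h3]
  congr 2
  push_cast
  ring

theorem mainTheorem8 :
    -- (a) the function `ω_B`
    ((∃ Ω : ℂ → ℂ, IsMeromorphicContinuation omegaBTerm (1 / 2) Ω) ∧
      (∀ Ω : ℂ → ℂ, IsMeromorphicContinuation omegaBTerm (1 / 2) Ω → ∀ n : ℕ,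
        HasResidueAt Ω ((1 - (n : ℂ)) / 3)
          (1 / 3 * riemannZeta ((1 - 4 * (n : ℂ)) / 3) *
            (1 + (2 : ℂ) ^ ((-1 - 2 * (n : ℂ)) / 3)) * (bCoeff n : ℂ))) ∧
      (∀ n : ℕ, ∃ q : ℚ, bCoeff n = (q : ℝ)) ∧
      (∀ n : ℕ,
        27 * ((n : ℝ) + 4) * ((n : ℝ) + 6) * bCoeff (n + 6)
          - 4 * ((n : ℝ) + 2) * ((n : ℝ) + 5) * bCoeff n = 0)) ∧
    -- (b) the function `ω_G`
    ((∃ Ω : ℂ → ℂ, IsMeromorphicContinuation omegaGTerm (1 / 3) Ω) ∧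
      (∀ Ω : ℂ → ℂ, IsMeromorphicContinuation omegaGTerm (1 / 3) Ω → ∀ n : ℕ,
        HasResidueAt Ω ((1 - (n : ℂ)) / 5)
          (1 / 5 * riemannZeta ((1 - 6 * (n : ℂ)) / 5) *
            (1 + (3 : ℂ) ^ ((-3 * (n : ℂ) - 2) / 5)) *
            (2 : ℂ) ^ (((n : ℂ) - 1) / 5) * (gCoeff n : ℂ))) ∧
      (∀ n : ℕ, ∃ q : ℚ, gCoeff n = (q : ℝ)) ∧
      (∀ n : ℕ,
        729 * ((n : ℝ) + 4) * ((n : ℝ) + 9) * ((n : ℝ) + 14) * ((n : ℝ) + 19)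
            * (6 * (n : ℝ) + 103) * gCoeff n
          - 1875 * ((n : ℝ) + 14) * ((n : ℝ) + 19)
            * (216 * (n : ℝ) ^ 3 + 7596 * (n : ℝ) ^ 2 + 83694 * (n : ℝ) + 290603)
            * gCoeff (n + 10)
          + 50000 * ((n : ℝ) + 12) * ((n : ℝ) + 16) * ((n : ℝ) + 18) * ((n : ℝ) + 20)
            * (6 * (n : ℝ) + 43) * gCoeff (n + 20) = 0)) := by
  have hσB : 2 / (((3 : ℕ) : ℝ) + 1) = 1 / 2 := by norm_num
  have hσG : 2 / (((5 : ℕ) : ℝ) + 1) = 1 / 3 := by norm_num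
  refine ⟨⟨?_, ?_, exists_rat_bCoeff, bCoeff_recurrence⟩,
    ⟨?_, ?_, exists_rat_gCoeff, gCoeff_recurrence⟩⟩
  · rw [← hσB]
    exact coneSeries_omegaB.exists_continuation
  · intro Ω hΩ n
    rw [← hσB] at hΩ
    have h := coneSeries_omegaB.hasResidueAt hΩ n
    have hz : (((3 : ℕ) : ℂ) + 1) * ((1 - (n : ℂ)) / (3 : ℕ)) - 1 = (1 - 4 * (n : ℂ)) / 3 := by
      push_cast; ring
    rw [hz] at h
    push_cast at h
    rw [two_cpow_mul_half_pow, Complex.one_cpow, one_pow, one_mul] at h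
    rw [bCoeff_eq_expansionCoeff]
    exact h
  · rw [← hσG]
    exact coneSeries_omegaG.exists_continuation
  · intro Ω hΩ n
    rw [← hσG] at hΩ
    have h := coneSeries_omegaG.hasResidueAt hΩ n
    have hz : (((5 : ℕ) : ℂ) + 1) * ((1 - (n : ℂ)) / (5 : ℕ)) - 1 = (1 - 6 * (n : ℂ)) / 5 := by
      push_cast; ring
    rw [hz] at h
    push_cast at h
    rw [eighteen_cpow_mul_third_pow, one_pow, mul_one] at h
    rw [gCoeff_eq_expansionCoeff]
    convert! h using 1
    ring
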